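/- Let $N\ge 2$ and let $\mathbb T^N=\mathbb R^N/\mathbb Z^N$ be the flat torus with the quotient Euclidean distance and Lebesgue measure $|\cdot|$ (so $|\mathbb T^N|=1$). For measurable $F\subset\mathbb T^N$ let $$P(F)=\sup\Big\{\int_F \operatorname{div}\varphi\,dx:\ \varphi\in C^1(\mathbb T^N;\mathbb R^N),\ |\varphi|\le 1\Big\}\in[0,\infty]$$ be its perimeter. For $h>0$ and $G\subset\mathbb T^N$ put $$J_h^G(F)=P(F)+\frac1h\int_{F\triangle G}\operatorname{dist}(x,\partial G)\,dx ,$$ where $G$ is assumed to coincide with its Lebesgue representative (its set of points of density one) and $\partial G$ is its topological boundary. A volume-constrained minimizer of $J_h^G$ is a measurable set $F$ with $|F|=|G|$ and $J_h^G(F)\le J_h^G(F')$ for every measurable $F'$ with $|F'|=|G|$. A lamella is a set of the form $\{x\in\mathbb R^N: a<p\cdot x<b\}$ projected to $\mathbb T^N$, where $p\in\mathbb Z^N$ has coprime entries and $a<b<a+1$; that is, an open strip between two parallel hyperplanes, with rational normal direction, that does not close up on itself. **Proposition.** For every $h>0$ there exist $m>0$, a sequence $(E_n)_{n\in\mathbb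 N}$ of measurable subsets of $\mathbb T^N$ that coincide with their Lebesgue representatives, a lamella $E$ and a measurable set $F\subset\mathbb T^N$ such that * $|E_n|=m$ for every $n$, and $\sup_n P(E_n)<\infty$; * $|E_n\triangle E|\to 0$ and $P(E_n)\to P(E)$; * for every $n$ the functional $J_h^{E_n}$ has a volume-constrained minimizer, and for every choice of volume-constrained minimizers $F_n$ of $J_h^{E_n}$ one has $|F_n\triangle F|\to 0$; * $|E\triangle F|>0$. -/

import Mathlib

open MeasureTheory Filter Topology
open scoped ENNReal NNReal symmDiff

/-- The flat torus `ℝ^N / ℤ^N`. The `ℓ²` product of the circles `ℝ / ℤ` carries the distance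
`dist x y = min_{z ∈ ℤ^N} |(x + z) - y|` with `|·|` the Euclidean norm. -/
abbrev Torus (N : ℕ) : Type := PiLp 2 (fun _ : Fin N => UnitAddCircle)

namespace Torus

/-- The quotient map `ℝ^N → ℝ^N / ℤ^N`. -/
def proj {N : ℕ} (x : EuclideanSpace ℝ (Fin N)) : Torus N :=
  WithLp.toLp 2 (fun i => ((x i : ℝ) : UnitAddCircle))

/-- Lebesgue measure on the torus (of total mass one): the product of the Lebesgue measures
of the circles `ℝ / ℤ`. -/
noncomputable def vol (N : ℕ) : Measure (Torus N) :=
  (volume : Measure (Fin N → UnitAddCircle)).map (WithLp.toLp 2)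

/-- The divergence of a vector field on the torus: the sum of its partial derivatives
`∂ᵢ Xᵢ`, each computed along the line `s ↦ x + s eᵢ`. -/
noncomputable def divergence {N : ℕ} (X : Torus N → EuclideanSpace ℝ (Fin N)) (x : Torus N) : ℝ :=
  ∑ i : Fin N, deriv (fun s : ℝ => X (x + proj (EuclideanSpace.single i s)) i) 0

/-- Vector fields `X ∈ C¹(𝕋^N; ℝ^N)` with `|X| ≤ 1`. A field on the torus is of class `C¹`
when its periodic lift to `ℝ^N` is. -/
def IsTestField {N : ℕ} (X : Torus N → EuclideanSpace ℝ (Fin N)) : Prop :=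
  ContDiff ℝ 1 (fun y : EuclideanSpace ℝ (Fin N) => X (proj y)) ∧ ∀ x, ‖X x‖ ≤ 1

/-- The perimeter of a measurable set, that is, the total variation of its characteristic
function. It is `⊤` when the set is not of finite perimeter. -/
noncomputable def perimeter {N : ℕ} (E : Set (Torus N)) : ℝ≥0∞ :=
  ⨆ (X : Torus N → EuclideanSpace ℝ (Fin N)) (_ : IsTestField X),
    ENNReal.ofReal (∫ x in E, divergence X x ∂(vol N))

/-- The Lebesgue representative of a measurable set: its points of density one. -/
def lebesgueRep {N : ℕ} (E : Set (Torus N)) : Set (Torus N) :=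
  {x | Tendsto (fun r : ℝ => vol N (E ∩ Metric.ball x r) / vol N (Metric.ball x r))
    (𝓝[>] 0) (𝓝 1)}

/-- The one-step functional
`J_h^G(F) = P(F) + (1/h) ∫_{F ∆ G} dist(x, ∂G) dx`. -/
noncomputable def J {N : ℕ} (h : ℝ) (G F : Set (Torus N)) : ℝ≥0∞ :=
  perimeter F + ENNReal.ofReal (1 / h) *
    ∫⁻ x in F ∆ G, ENNReal.ofReal (Metric.infDist x (frontier G)) ∂(vol N)

/-- `F` is a volume-constrained minimizer of `J_h^G`: it minimizes `J_h^G` among the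
measurable sets with the same volume as `G`. -/
def IsVolumeConstrainedMinimizer {N : ℕ} (h : ℝ) (G F : Set (Torus N)) : Prop :=
  MeasurableSet F ∧ vol N F = vol N G ∧
    ∀ F' : Set (Torus N), MeasurableSet F' → vol N F' = vol N G → J h G F ≤ J h G F'

/-- A lamella: the image in the torus of an open strip of `ℝ^N` between two parallel
hyperplanes. For the image to be a proper region of the torus bounded by hyperplanes, the normal
direction has to be rational, so it is spanned by an integer vector `p` with coprime entries; the
strip `a < p · x < b` and its integer translates are then disjoint, with disjoint closures,
exactly when `b < a + 1`. -/
def IsLamella {N : ℕ} (E : Set (Torus N)) : Prop :=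
  ∃ (p : Fin N → ℤ) (a b : ℝ), Finset.univ.gcd p = 1 ∧ a < b ∧ b < a + 1 ∧
    E = proj '' {x : EuclideanSpace ℝ (Fin N) | a < ∑ i, (p i : ℝ) * x i ∧ ∑ i, (p i : ℝ) * x i < b}

end Torus

/-!
The lamella is the strip `E = {‖x₀‖ < 1 / 32}`, of volume `1 / 16` and perimeter `2`. It is not a
solution of the isoperimetric problem for its volume: the product of two arcs of length `1 / 4` and
the remaining circles has the same volume and perimeter at most `1`. Among the sets of volume
`1 / 16` and least perimeter, let `F` be one for which `|F ∆ E|` is least, and put `D = F ∆ E`.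
The sets `Eₙ` arise from `E` by
perforations that add almost no perimeter and alter only a set of small volume, but create so
much boundary that the dissipation term of the functional becomes negligible: it then costs nothing
to jump from `Eₙ` to an isoperimetric set. The perforations are arranged so that among the
isoperimetric sets the jump selects `F`.

To perforate a strip means to remove closed cubes inside it and to add open cubes outside it
(`perforated`); the width of the strip compensates for the volume of the cubes, and as `N ≥ 2` the
perimeter of the cubes tends to zero with their side, for any fixed set of centers
(`exists_isPerforation`). The resulting open set is its own Lebesgue representative, as its
complement contains a cube of size comparable to `t` near each of its points at every small scale
`t` (`lebesgueRep_eq_self`). The centers are the points of a grid and of a very fine net of a large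
compact part of `D`. The grid makes the distance to the boundary `∂Eₙ` at most comparable to the
mesh; on most of the complement of `D` this distance exceeds some `εₙ`, a small multiple of the
mesh, while its integral over `D` is at most `ηₙ εₙ` with `ηₙ → 0` (`exists_perforated_strip`).

Comparing a minimizer `Fₙ` with `F` therefore shows that the perimeter of `Fₙ` tends to the least
one and, after division by `εₙ`, that `|(Fₙ ∆ E) \ D| → 0`
(`IsVolumeConstrainedMinimizer.estimates`). By compactness, every limit `F'` along an ultrafilter
has least perimeter and satisfies `F' ∆ E ⊆ F ∆ E` up to a null set. By the choice of `F` the two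
symmetric differences agree, so `F' = F` (`tendsto_of_isoperimetric_closest`). Finally `F ≠ E` since
the perimeter of `F` is at most `1`.

The existence of minimizers and of limits rests on two facts about the complete pseudometric space
`MeasuredSets (vol N)` of measurable sets with the distance `|A ∆ B|`. The perimeter is lower
semicontinuous (`lowerSemicontinuous_perimeter`), and the sets of perimeter at most `C` form a
compact set (`isCompact_perimeter_le`). For the latter, a translation by `v` moves such a set by at
most `C ∑ |vᵢ|` in volume (`real_translate_le`), so the set is close to its averages over a small
cube, and these are equicontinuous functions. The converse estimate `perimeter_le_of_translate`
gives the upper bounds for the perimeters of boxes.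
-/

namespace Torus

variable {N : ℕ}

/-! ### The torus as a compact probability space -/

instance : CompactSpace (Torus N) :=
  (PiLp.homeomorph 2 (fun _ : Fin N => UnitAddCircle)).symm.compactSpace

/-- The measurable identification of the torus with the product of the circles. -/
def measurableEquivPi (N : ℕ) : Torus N ≃ᵐ (Fin N → UnitAddCircle) :=
  (MeasurableEquiv.toLp 2 (Fin N → UnitAddCircle)).symm

theorem vol_eq_map : vol N = (volume : Measure (Fin N → UnitAddCircle)).map
    (measurableEquivPi N).symm := rfl

theorem vol_apply (A : Set (Fin N → UnitAddCircle)) :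
    vol N {x | (fun i => x i) ∈ A} = volume A := by
  rw [vol_eq_map, MeasurableEquiv.map_apply]
  rfl

theorem vol_pi (A : Fin N → Set UnitAddCircle) :
    vol N {x | ∀ i, x i ∈ A i} = ∏ i, volume (A i) := by
  have := vol_apply (Set.univ.pi A)
  simp only [Set.mem_univ_pi] at this
  rw [this, volume_pi, Measure.pi_pi]

instance : IsProbabilityMeasure (vol N) := ⟨by
  have := vol_pi (N := N) (fun _ => Set.univ)
  simpa using this⟩

instance : (vol N).IsAddLeftInvariant := ⟨fun g => by
  rw [vol_eq_map, Measure.map_map (by fun_prop) (by fun_prop)]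
  have h := (measurePreserving_add_left (volume : Measure (Fin N → UnitAddCircle))
    (measurableEquivPi N g)).map_eq
  conv_rhs => rw [← h]
  rw [Measure.map_map (by fun_prop) (by fun_prop)]
  rfl⟩

/-- The open ball of radius `ρ ≤ 1 / 2` in the circle has length `2 ρ`. -/
theorem _root_.UnitAddCircle.volume_ball (y : UnitAddCircle) {ρ : ℝ}
    (h1 : ρ ≤ 1 / 2) : volume (Metric.ball y ρ) = ENNReal.ofReal (2 * ρ) := by
  apply le_antisymm
  · refine (measure_mono Metric.ball_subset_closedBall).trans ?_
    rw [AddCircle.volume_closedBall]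
    exact ENNReal.ofReal_le_ofReal (min_le_right _ _)
  · refine le_of_forall_lt fun c hc => ?_
    have hcont : Tendsto (fun r : ℝ => ENNReal.ofReal (2 * r)) (𝓝[<] ρ)
        (𝓝 (ENNReal.ofReal (2 * ρ))) :=
      ((ENNReal.continuous_ofReal.comp (continuous_const.mul continuous_id)).tendsto ρ).mono_left
        nhdsWithin_le_nhds
    obtain ⟨r, hcr, hr⟩ := ((hcont.eventually (lt_mem_nhds hc)).and self_mem_nhdsWithin).exists
    refine hcr.trans_le ?_
    have : volume (Metric.closedBall y r) = ENNReal.ofReal (2 * r) := by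
      have hr' : r < ρ := hr
      rw [AddCircle.volume_closedBall, min_eq_right (by linarith)]
    rw [← this]
    exact measure_mono (Metric.closedBall_subset_ball hr)

/-- The product of open arcs of half-lengths `r i` about `s i` for `i ∈ I`, with no condition on
the remaining coordinates. -/
def box (I : Finset (Fin N)) (s : Torus N) (r : Fin N → ℝ) : Set (Torus N) :=
  {x | ∀ i ∈ I, dist (x i) (s i) < r i}

theorem isOpen_box (I : Finset (Fin N)) (s : Torus N) (r : Fin N → ℝ) : IsOpen (box I s r) := by
  have : box I s r = ⋂ i ∈ I, {x | dist (x i) (s i) < r i} := by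
    ext x
    simp [box]
  rw [this]
  exact isOpen_biInter_finset fun i _ => isOpen_lt (by fun_prop) continuous_const

theorem vol_box (I : Finset (Fin N)) (s : Torus N) {r : Fin N → ℝ}
    (h0 : ∀ i ∈ I, 0 ≤ r i) (h1 : ∀ i ∈ I, r i ≤ 1 / 2) :
    vol N (box I s r) = ENNReal.ofReal (∏ i ∈ I, (2 * r i)) := by
  classical
  have : box I s r = {x : Torus N | ∀ i, x i ∈ if i ∈ I then Metric.ball (s i) (r i)
      else Set.univ} := by
    ext x
    simp only [box, Set.mem_ofPred_eq]
    refine forall_congr' fun i => ?_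
    by_cases hi : i ∈ I <;> simp [hi]
  rw [this, vol_pi, ENNReal.ofReal_prod_of_nonneg (fun i hi => by linarith [h0 i hi]),
    ← Finset.prod_subset (Finset.subset_univ I)]
  · refine Finset.prod_congr rfl fun i hi => ?_
    rw [if_pos hi, UnitAddCircle.volume_ball _ (h1 i hi)]
  · intro i _ hi
    rw [if_neg hi, UnitAddCircle.measure_univ]

/-! ### The quotient map and partial derivatives -/

@[simp] theorem proj_apply (y : EuclideanSpace ℝ (Fin N)) (i : Fin N) :
    proj y i = ((y i : ℝ) : UnitAddCircle) := rfl

theorem proj_add (y z : EuclideanSpace ℝ (Fin N)) : proj (y + z) = proj y + proj z := by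
  ext i
  simp

theorem isOpenQuotientMap_proj : IsOpenQuotientMap (proj (N := N)) := by
  have h1 : IsOpenQuotientMap (Pi.map (fun (_ : Fin N) (t : ℝ) => (t : UnitAddCircle))) :=
    IsOpenQuotientMap.piMap fun _ => QuotientAddGroup.isOpenQuotientMap_mk
  exact ((PiLp.homeomorph 2 (fun _ : Fin N => UnitAddCircle)).symm.isOpenQuotientMap.comp h1).comp
    (PiLp.homeomorph 2 (fun _ : Fin N => ℝ)).isOpenQuotientMap

theorem continuous_proj : Continuous (proj (N := N)) := isOpenQuotientMap_proj.continuous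

theorem continuous_iff_comp_proj {α : Type*} [TopologicalSpace α] {g : Torus N → α} :
    Continuous g ↔ Continuous (fun y => g (proj y)) :=
  isOpenQuotientMap_proj.isQuotientMap.continuous_iff

/-- The translation of the torus by `t` in the direction of the `i`-th coordinate axis, as an
element of the torus. -/
noncomputable def axis (i : Fin N) (t : ℝ) : Torus N := proj (EuclideanSpace.single i t)

theorem axis_add (i : Fin N) (s t : ℝ) : axis i (s + t) = axis i s + axis i t := by
  rw [axis, axis, axis, ← proj_add]
  congr 1
  ext j
  by_cases h : j = i <;> simp [h]

@[simp] theorem axis_zero (i : Fin N) : axis i 0 = 0 := by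
  ext j
  by_cases h : j = i <;> simp [axis, h]

theorem axis_apply_self (i : Fin N) (t : ℝ) : axis i t i = (t : UnitAddCircle) := by
  simp [axis]

theorem axis_apply_of_ne {i j : Fin N} (h : j ≠ i) (t : ℝ) : axis i t j = 0 := by
  simp [axis, h]

theorem single_eq_smul (i : Fin N) : (EuclideanSpace.single i : ℝ → EuclideanSpace ℝ (Fin N)) =
    fun s => s • EuclideanSpace.single i (1 : ℝ) := by
  ext s j
  by_cases h : j = i <;> simp [h]

theorem continuous_axis (i : Fin N) : Continuous (axis i) := by
  unfold axis
  rw [single_eq_smul]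
  exact continuous_proj.comp (by fun_prop)

/-- A function on the torus is of class `C¹` when its periodic lift is. -/
def IsC1 (g : Torus N → ℝ) : Prop :=
  ContDiff ℝ 1 (fun y : EuclideanSpace ℝ (Fin N) => g (proj y))

/-- The `i`-th partial derivative of a function on the torus. -/
noncomputable def pderiv (i : Fin N) (g : Torus N → ℝ) (x : Torus N) : ℝ :=
  deriv (fun s : ℝ => g (x + axis i s)) 0

theorem divergence_eq (X : Torus N → EuclideanSpace ℝ (Fin N)) (x : Torus N) :
    divergence X x = ∑ i, pderiv i (fun z => X z i) x := rfl

theorem IsC1.continuous {g : Torus N → ℝ} (hg : IsC1 g) : Continuous g :=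
  continuous_iff_comp_proj.2 (ContDiff.continuous hg)

theorem IsC1.comp_add_right {g : Torus N → ℝ} (hg : IsC1 g) (v : Torus N) :
    IsC1 (fun x => g (x + v)) := by
  obtain ⟨w, rfl⟩ := isOpenQuotientMap_proj.surjective v
  have : (fun y : EuclideanSpace ℝ (Fin N) => g (proj y + proj w)) =
      (fun y => g (proj y)) ∘ fun y => y + w := by
    ext y
    simp [proj_add]
  unfold IsC1
  rw [this]
  exact ContDiff.comp hg (contDiff_id.add contDiff_const)

theorem IsC1.hasDerivAt_proj {g : Torus N → ℝ} (hg : IsC1 g) (i : Fin N)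
    (y : EuclideanSpace ℝ (Fin N)) :
    HasDerivAt (fun s : ℝ => g (proj y + axis i s))
      (fderiv ℝ (fun y => g (proj y)) y (EuclideanSpace.single i 1)) 0 := by
  have h1 : HasFDerivAt (fun y => g (proj y)) (fderiv ℝ (fun y => g (proj y)) y)
      (y + EuclideanSpace.single i (0 : ℝ)) := by
    have : EuclideanSpace.single i (0 : ℝ) = 0 := by simp
    rw [this, add_zero]
    exact (ContDiff.differentiable hg one_ne_zero y).hasFDerivAt
  have h2 : HasDerivAt (fun s : ℝ => y + EuclideanSpace.single i s)
      (EuclideanSpace.single i (1 : ℝ)) 0 := by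
    have h3 : HasDerivAt (fun s : ℝ => y + s • EuclideanSpace.single i (1 : ℝ))
        ((1 : ℝ) • EuclideanSpace.single i (1 : ℝ)) 0 :=
      ((hasDerivAt_id (0 : ℝ)).smul_const _).const_add y
    rw [one_smul] at h3
    convert h3 using 3 with s
    exact congrFun (single_eq_smul i) s
  have h4 := h1.comp_hasDerivAt (0 : ℝ) h2
  refine h4.congr_of_eventuallyEq (Eventually.of_forall fun s => ?_)
  simp only [Function.comp, proj_add]
  rfl

theorem IsC1.pderiv_proj {g : Torus N → ℝ} (hg : IsC1 g) (i : Fin N)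
    (y : EuclideanSpace ℝ (Fin N)) :
    pderiv i g (proj y) = fderiv ℝ (fun y => g (proj y)) y (EuclideanSpace.single i 1) :=
  (hg.hasDerivAt_proj i y).deriv

theorem IsC1.hasDerivAt {g : Torus N → ℝ} (hg : IsC1 g) (i : Fin N) (x : Torus N) (t : ℝ) :
    HasDerivAt (fun s : ℝ => g (x + axis i s)) (pderiv i g (x + axis i t)) t := by
  obtain ⟨y, hy⟩ := isOpenQuotientMap_proj.surjective (x + axis i t)
  have h := hg.hasDerivAt_proj i y
  rw [← hg.pderiv_proj, hy] at h
  have h2 : HasDerivAt (fun s : ℝ => s - t) 1 t := (hasDerivAt_id t).sub_const t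
  have h3 := HasDerivAt.comp_of_eq t h h2 (sub_self t).symm
  rw [mul_one] at h3
  refine h3.congr_of_eventuallyEq (Eventually.of_forall fun s => ?_)
  simp only [Function.comp]
  rw [add_assoc, ← axis_add]
  congr 3
  ring

theorem IsC1.continuous_pderiv {g : Torus N → ℝ} (hg : IsC1 g) (i : Fin N) :
    Continuous (pderiv i g) := by
  rw [continuous_iff_comp_proj]
  simp_rw [hg.pderiv_proj i]
  exact (ContDiff.continuous_fderiv hg one_ne_zero).clm_apply continuous_const

theorem _root_.Continuous.integrable_torus {g : Torus N → ℝ} (hg : Continuous g)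
    (F : Set (Torus N)) : Integrable g ((vol N).restrict F) := by
  obtain ⟨C, hC⟩ := isCompact_univ.exists_bound_of_continuousOn hg.continuousOn
  exact Integrable.of_bound hg.aestronglyMeasurable C (Eventually.of_forall fun x => hC x trivial)

/-- Differentiation under the integral sign along the translations in one direction. -/
theorem IsC1.hasDerivAt_setIntegral {g : Torus N → ℝ} (hg : IsC1 g) (i : Fin N)
    (F : Set (Torus N)) (t : ℝ) :
    HasDerivAt (fun s : ℝ => ∫ x in F, g (x + axis i s) ∂(vol N))
      (∫ x in F, pderiv i g (x + axis i t) ∂(vol N)) t := by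
  obtain ⟨C, hC⟩ := isCompact_univ.exists_bound_of_continuousOn
    (hg.continuous_pderiv i).continuousOn
  have hc : ∀ s, Continuous fun x => g (x + axis i s) := fun s =>
    hg.continuous.comp (continuous_id.add continuous_const)
  refine (hasDerivAt_integral_of_dominated_loc_of_deriv_le (s := Set.univ)
    (F' := fun s x => pderiv i g (x + axis i s)) (bound := fun _ => C) univ_mem ?_ ?_ ?_ ?_ ?_ ?_).2
  · exact Eventually.of_forall fun s => (hc s).aestronglyMeasurable
  · exact (hc t).integrable_torus F
  · exact ((hg.continuous_pderiv i).comp (continuous_id.add continuous_const)).aestronglyMeasurable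
  · exact Eventually.of_forall fun x s _ => hC _ trivial
  · exact integrable_const C
  · exact Eventually.of_forall fun x s _ => hg.hasDerivAt i x s

/-! ### Perimeter and translations -/

theorem perimeter_congr {F G : Set (Torus N)} (h : F =ᵐ[vol N] G) :
    perimeter F = perimeter G := by
  unfold perimeter
  simp_rw [setIntegral_congr_set h]

theorem IsTestField.le_perimeter {X : Torus N → EuclideanSpace ℝ (Fin N)} (hX : IsTestField X)
    (F : Set (Torus N)) :
    ENNReal.ofReal (∫ x in F, divergence X x ∂(vol N)) ≤ perimeter F :=
  le_iSup₂ (f := fun (X : Torus N → EuclideanSpace ℝ (Fin N)) (_ : IsTestField X) =>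
    ENNReal.ofReal (∫ x in F, divergence X x ∂(vol N))) X hX

theorem IsTestField.isC1 {X : Torus N → EuclideanSpace ℝ (Fin N)} (hX : IsTestField X)
    (i : Fin N) : IsC1 (fun x => X x i) :=
  (contDiff_euclidean.1 hX.1) i

theorem IsTestField.abs_le {X : Torus N → EuclideanSpace ℝ (Fin N)} (hX : IsTestField X)
    (i : Fin N) (x : Torus N) : |X x i| ≤ 1 :=
  (PiLp.norm_apply_le (X x) i).trans (hX.2 x)

theorem IsTestField.continuous_divergence {X : Torus N → EuclideanSpace ℝ (Fin N)}
    (hX : IsTestField X) : Continuous (divergence X) :=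
  continuous_finsetSum _ fun i _ => (hX.isC1 i).continuous_pderiv i

theorem IsTestField.neg {X : Torus N → EuclideanSpace ℝ (Fin N)} (hX : IsTestField X) :
    IsTestField (fun x => - X x) :=
  ⟨ContDiff.neg hX.1, fun x => by rw [norm_neg]; exact hX.2 x⟩

theorem divergence_neg (X : Torus N → EuclideanSpace ℝ (Fin N)) (x : Torus N) :
    divergence (fun x => - X x) x = - divergence X x := by
  simp only [divergence_eq, ← Finset.sum_neg_distrib]
  refine Finset.sum_congr rfl fun i _ => ?_
  exact deriv.fun_neg

/-- A `C¹` function bounded by one gives a test field pointing in the direction `i`. -/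
theorem IsC1.isTestField {g : Torus N → ℝ} (hg : IsC1 g) (h1 : ∀ x, |g x| ≤ 1) (i : Fin N) :
    IsTestField (fun x => EuclideanSpace.single i (g x)) := by
  refine ⟨?_, fun x => by simpa using h1 x⟩
  rw [contDiff_euclidean]
  intro j
  by_cases h : j = i
  · subst h
    simpa [IsC1] using hg
  · simpa [h] using contDiff_const

theorem divergence_single (g : Torus N → ℝ) (i : Fin N) (x : Torus N) :
    divergence (fun x => EuclideanSpace.single i (g x)) x = pderiv i g x := by
  rw [divergence_eq, Finset.sum_eq_single i]
  · simp
  · intro j _ hj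
    simp [hj, pderiv]
  · simp

/-- The translate `F + v`. -/
def translate (v : Torus N) (F : Set (Torus N)) : Set (Torus N) := (fun x => x - v) ⁻¹' F

theorem measurePreserving_add (v : Torus N) :
    MeasurePreserving (fun x => x + v) (vol N) (vol N) :=
  measurePreserving_add_right (vol N) v

theorem _root_.MeasurableSet.translate {F : Set (Torus N)} (hF : MeasurableSet F) (v : Torus N) :
    MeasurableSet (translate v F) :=
  hF.preimage (by fun_prop)

theorem vol_translate (v : Torus N) (F : Set (Torus N)) :
    vol N (translate v F) = vol N F := by
  have h : (fun x => x + -v) ⁻¹' F = translate v F := by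
    ext x
    simp [translate, sub_eq_add_neg]
  rw [← h]
  exact measure_preimage_add_right (vol N) (-v) F

theorem translate_translate (v w : Torus N) (F : Set (Torus N)) :
    translate v (translate w F) = translate (v + w) F := by
  ext x
  simp [translate, sub_sub]

@[simp] theorem translate_zero (F : Set (Torus N)) : translate 0 F = F := by
  ext x
  simp [translate]

theorem translate_symmDiff (v : Torus N) (F G : Set (Torus N)) :
    translate v (F ∆ G) = translate v F ∆ translate v G := rfl

theorem setIntegral_comp_add (g : Torus N → ℝ) (v : Torus N) (F : Set (Torus N)) :
    ∫ x in F, g (x + v) ∂(vol N) = ∫ x in translate v F, g x ∂(vol N) := by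
  rw [← (measurePreserving_add v).setIntegral_preimage_emb (measurableEmbedding_addRight v) g]
  congr 2
  ext x
  simp [translate]

theorem abs_setIntegral_le {g : Torus N → ℝ} {C : ℝ} {S : Set (Torus N)}
    (hC : ∀ x ∈ S, |g x| ≤ C) : |∫ x in S, g x ∂(vol N)| ≤ C * (vol N).real S :=
  norm_setIntegral_le_of_norm_le_const (f := g) (measure_lt_top _ _) hC

theorem setIntegral_sub_setIntegral {g : Torus N → ℝ} (hg : Continuous g) {A B : Set (Torus N)}
    (hA : MeasurableSet A) (hB : MeasurableSet B) :
    ∫ x in A, g x ∂(vol N) - ∫ x in B, g x ∂(vol N) =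
      ∫ x in A \ B, g x ∂(vol N) - ∫ x in B \ A, g x ∂(vol N) := by
  rw [← integral_inter_add_sdiff hB (hg.integrable_torus A),
    ← integral_inter_add_sdiff hA (hg.integrable_torus B), Set.inter_comm]
  ring

theorem real_symmDiff {A B : Set (Torus N)} (hA : MeasurableSet A) (hB : MeasurableSet B) :
    (vol N).real (A ∆ B) = (vol N).real (A \ B) + (vol N).real (B \ A) :=
  measureReal_union (disjoint_sdiff_sdiff) (hB.diff hA)

theorem abs_setIntegral_sub_setIntegral_le {g : Torus N → ℝ} (hg : Continuous g) {C : ℝ}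
    (hC : ∀ x, |g x| ≤ C) {A B : Set (Torus N)} (hA : MeasurableSet A) (hB : MeasurableSet B) :
    |∫ x in A, g x ∂(vol N) - ∫ x in B, g x ∂(vol N)| ≤ C * (vol N).real (A ∆ B) := by
  rw [setIntegral_sub_setIntegral hg hA hB, real_symmDiff hA hB, mul_add]
  refine (abs_sub _ _).trans (add_le_add ?_ ?_)
  · exact abs_setIntegral_le fun x _ => hC x
  · exact abs_setIntegral_le fun x _ => hC x

/-- If the volume of `F ∆ (F + t eᵢ)` is at most `c i * t` for small `t > 0`, then the perimeter of
`F` is at most the sum of the `c i`. -/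
theorem perimeter_le_of_translate {F : Set (Torus N)} (hF : MeasurableSet F) (c : Fin N → ℝ)
    (h : ∀ i, ∀ᶠ t in 𝓝[>] (0 : ℝ), (vol N).real (translate (axis i t) F ∆ F) ≤ c i * t) :
    perimeter F ≤ ENNReal.ofReal (∑ i, c i) := by
  refine iSup₂_le fun X hX => ENNReal.ofReal_le_ofReal ?_
  simp only [divergence_eq]
  rw [integral_finsetSum _ fun i _ => ((hX.isC1 i).continuous_pderiv i).integrable_torus F]
  refine Finset.sum_le_sum fun i _ => ?_
  have hd := (hX.isC1 i).hasDerivAt_setIntegral i F 0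
  simp only [axis_zero, add_zero] at hd
  have ht := hd.tendsto_slope_zero_right
  refine le_of_tendsto ht ?_
  filter_upwards [h i, self_mem_nhdsWithin] with t h1 h2
  have h2 : 0 < t := h2
  rw [zero_add, axis_zero, smul_eq_mul, inv_mul_le_iff₀ h2,
    setIntegral_comp_add (fun x => X x i)]
  simp only [add_zero]
  refine (le_abs_self _).trans ((abs_setIntegral_sub_setIntegral_le (hX.isC1 i).continuous
    (hX.abs_le i) (hF.translate _) hF).trans ?_)
  rw [one_mul, mul_comm]
  exact h1

/-- The `C¹` functions on the torus form an algebra. -/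
def c1Subalgebra (N : ℕ) : Subalgebra ℝ C(Torus N, ℝ) where
  carrier := {g | IsC1 g}
  mul_mem' {a b} (h1 : IsC1 a) (h2 : IsC1 b) := show IsC1 _ from ContDiff.mul h1 h2
  add_mem' {a b} (h1 : IsC1 a) (h2 : IsC1 b) := show IsC1 _ from ContDiff.add h1 h2
  algebraMap_mem' c := show IsC1 (fun _ => c) from contDiff_const

theorem isC1_im_toCircle (n : ℤ) (i : Fin N) :
    IsC1 (fun x : Torus N => (AddCircle.toCircle (n • x i) : ℂ).im) := by
  have : (fun y : EuclideanSpace ℝ (Fin N) =>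
      (AddCircle.toCircle (n • (proj y i)) : ℂ).im) =
      fun y => Real.sin (2 * Real.pi * (n * y i)) := by
    ext y
    rw [proj_apply, ← AddCircle.coe_zsmul, AddCircle.toCircle_apply_mk, Circle.coe_exp,
      Complex.exp_ofReal_mul_I_im, div_one, zsmul_eq_mul]
  unfold IsC1
  rw [this]
  fun_prop

theorem isC1_re_toCircle (i : Fin N) :
    IsC1 (fun x : Torus N => (AddCircle.toCircle (x i) : ℂ).re) := by
  have : (fun y : EuclideanSpace ℝ (Fin N) => (AddCircle.toCircle (proj y i) : ℂ).re) =
      fun y => Real.cos (2 * Real.pi * y i) := by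
    ext y
    rw [proj_apply, AddCircle.toCircle_apply_mk, Circle.coe_exp,
      Complex.exp_ofReal_mul_I_re, div_one]
  unfold IsC1
  rw [this]
  fun_prop

theorem c1Subalgebra_separatesPoints : (c1Subalgebra N).SeparatesPoints := by
  intro x y hxy
  obtain ⟨i, hi⟩ : ∃ i, x i ≠ y i := by
    by_contra! h
    exact hxy (PiLp.ext h)
  by_contra! h
  refine hi (AddCircle.injective_toCircle one_ne_zero (Circle.ext (Complex.ext ?_ ?_)))
  · exact h _ ⟨⟨_, (isC1_re_toCircle i).continuous⟩, isC1_re_toCircle i, rfl⟩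
  · have := h _ ⟨⟨_, (isC1_im_toCircle 1 i).continuous⟩, isC1_im_toCircle 1 i, rfl⟩
    simpa using this

/-- Continuous functions with values in `[-1, 1]` are uniform limits of `C¹` functions with values
in `[-1, 1]`. -/
theorem exists_isC1_near {f : Torus N → ℝ} (hf : Continuous f) (h1 : ∀ x, |f x| ≤ 1) {ε : ℝ}
    (hε : 0 < ε) : ∃ g : Torus N → ℝ, IsC1 g ∧ (∀ x, |g x| ≤ 1) ∧ ∀ x, |g x - f x| ≤ 2 * ε := by
  obtain ⟨⟨g, hg⟩, hgf⟩ :=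
    ContinuousMap.exists_mem_subalgebra_near_continuous_of_separatesPoints (c1Subalgebra N)
      c1Subalgebra_separatesPoints f hf ε hε
  simp only [Real.norm_eq_abs] at hgf
  have hg : IsC1 g := hg
  have hb : ∀ x, |g x| ≤ 1 + ε := fun x => by
    have := abs_sub_abs_le_abs_sub (g x) (f x)
    linarith [hgf x, h1 x]
  have hpos : 0 < 1 + ε := by linarith
  refine ⟨fun x => (1 + ε)⁻¹ * g x, contDiff_const.mul hg, fun x => ?_, fun x => ?_⟩
  · rw [abs_mul, abs_of_pos (inv_pos.2 hpos), inv_mul_le_iff₀ hpos, mul_one]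
    exact hb x
  · have e : (1 + ε)⁻¹ * g x - g x = - (ε * ((1 + ε)⁻¹ * g x)) := by
      field_simp
      ring
    have h2 : |(1 + ε)⁻¹ * g x| ≤ 1 := by
      rw [abs_mul, abs_of_pos (inv_pos.2 hpos), inv_mul_le_iff₀ hpos, mul_one]
      exact hb x
    have h3 : |(1 + ε)⁻¹ * g x - g x| ≤ ε := by
      rw [e, abs_neg, abs_mul, abs_of_pos hε]
      nlinarith
    have := abs_sub_le ((1 + ε)⁻¹ * g x) (g x) (f x)
    linarith [hgf x]

/-- The volume of `A ∆ B` is detected by `C¹` functions with values in `[-1, 1]`: they approximate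
the function equal to `1` on `A \ B` and to `-1` on `B \ A`. -/
theorem real_symmDiff_le_of_forall_isC1 {A B : Set (Torus N)} (hA : MeasurableSet A)
    (hB : MeasurableSet B) {K : ℝ} (h : ∀ g : Torus N → ℝ, IsC1 g → (∀ x, |g x| ≤ 1) →
      ∫ x in A, g x ∂(vol N) - ∫ x in B, g x ∂(vol N) ≤ K) :
    (vol N).real (A ∆ B) ≤ K := by
  refine le_of_forall_pos_le_add fun δ hδ => ?_
  obtain ⟨ε, hε, rfl⟩ : ∃ ε, 0 < ε ∧ δ = 8 * ε := ⟨δ / 8, by linarith, by ring⟩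
  have hcomp : ∀ S : Set (Torus N), MeasurableSet S → ∃ C ⊆ S, IsClosed C ∧
      (vol N).real (S \ C) ≤ ε := by
    intro S hS
    obtain ⟨C, hCS, hC, hm⟩ := hS.exists_isClosed_sdiff_lt (measure_ne_top (vol N) S)
      (ENNReal.ofReal_pos.2 hε).ne'
    exact ⟨C, hCS, hC, ENNReal.toReal_le_of_le_ofReal hε.le hm.le⟩
  obtain ⟨C₁, h1s, h1c, h1m⟩ := hcomp (A \ B) (hA.diff hB)
  obtain ⟨C₂, h2s, h2c, h2m⟩ := hcomp (B \ A) (hB.diff hA)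
  obtain ⟨f, hf0, hf1, hf⟩ := exists_continuous_zero_one_of_isClosed h2c h1c
    (disjoint_sdiff_sdiff.symm.mono h2s h1s)
  obtain ⟨g, hg, hg1, hgf⟩ := exists_isC1_near (f := fun x => 2 * f x - 1) (by fun_prop)
    (fun x => by
      have := hf x
      rw [abs_le]
      constructor <;> linarith [this.1, this.2]) hε
  -- on each of the two pieces `S` the function `g` is close to its sign `s` off a small set
  have key : ∀ (S C : Set (Torus N)) (s : ℝ), MeasurableSet S → IsClosed C → C ⊆ S → |s| = 1 →
      (vol N).real (S \ C) ≤ ε → (∀ x ∈ C, 2 * f x - 1 = s) →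
      (vol N).real S ≤ s * ∫ x in S, g x ∂(vol N) + 4 * ε := by
    intro S C s hS hC hCS hs hm hfs
    have e1 : (vol N).real S = s * ∫ x in S, g x ∂(vol N) +
        ∫ x in S, (1 - s * g x) ∂(vol N) := by
      rw [integral_sub (integrable_const _) ((hg.continuous.integrable_torus S).const_mul s),
        integral_const_mul]
      simp
    have hint : Continuous fun x => 1 - s * g x := by
      have := hg.continuous
      fun_prop
    have e2 : ∫ x in S, (1 - s * g x) ∂(vol N) = ∫ x in C, (1 - s * g x) ∂(vol N) +
        ∫ x in S \ C, (1 - s * g x) ∂(vol N) := by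
      rw [← integral_inter_add_sdiff hC.measurableSet (hint.integrable_torus S),
        Set.inter_eq_self_of_subset_right hCS]
    have e3 : ∫ x in C, (1 - s * g x) ∂(vol N) ≤ 2 * ε * (vol N).real C :=
      (le_abs_self _).trans (abs_setIntegral_le
        fun x hx => by
          have hss : s * s = 1 := by rw [← abs_mul_abs_self, hs, one_mul]
          have : 1 - s * g x = - (s * (g x - (2 * f x - 1))) := by
            rw [hfs x hx]
            linear_combination -hss
          rw [this, abs_neg, abs_mul, hs, one_mul]
          exact hgf x)
    have e4 : ∫ x in S \ C, (1 - s * g x) ∂(vol N) ≤ 2 * (vol N).real (S \ C) :=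
      (le_abs_self _).trans (abs_setIntegral_le
        fun x _ => by
          have h5 : |s * g x| ≤ 1 := by
            rw [abs_mul, hs, one_mul]
            exact hg1 x
          rw [abs_le] at h5 ⊢
          constructor <;> linarith [h5.1, h5.2])
    have e5 : (vol N).real C ≤ 1 := measureReal_le_one
    nlinarith
  have k1 := key _ _ 1 (hA.diff hB) h1c h1s (by simp) h1m
    (fun x hx => by rw [hf1 hx]; norm_num)
  have k2 := key _ _ (-1) (hB.diff hA) h2c h2s (by simp) h2m
    (fun x hx => by rw [hf0 hx]; norm_num)
  have := h g hg hg1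
  rw [setIntegral_sub_setIntegral hg.continuous hA hB] at this
  rw [real_symmDiff hA hB]
  linarith

/-- The case of a translation along a coordinate axis: the integral of a `C¹` function `g` over the
translates of `F` has derivative at most `C`, since `g eᵢ` is a test field. -/
theorem real_translate_axis_le {F : Set (Torus N)} (hF : MeasurableSet F) {C : ℝ} (hC0 : 0 ≤ C)
    (hC : perimeter F ≤ ENNReal.ofReal C) (i : Fin N) (t : ℝ) :
    (vol N).real (translate (axis i t) F ∆ F) ≤ C * |t| := by
  refine real_symmDiff_le_of_forall_isC1 (hF.translate _) hF fun g hg hg1 => ?_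
  have hbound : ∀ g : Torus N → ℝ, IsC1 g → (∀ x, |g x| ≤ 1) → ∀ s,
      ∫ x in F, pderiv i g (x + axis i s) ∂(vol N) ≤ C := by
    intro g hg hg1 s
    have hX := (hg.comp_add_right (axis i s)).isTestField (fun x => hg1 _) i
    have := (hX.le_perimeter F).trans hC
    simp only [divergence_single] at this
    have h2 := (ENNReal.ofReal_le_ofReal_iff hC0).1 this
    refine le_trans (le_of_eq ?_) h2
    refine integral_congr_ae (Eventually.of_forall fun x => ?_)
    simp only [pderiv]
    congr 1
    ext r
    rw [add_right_comm]
  have hb2 : ∀ s, ‖∫ x in F, pderiv i g (x + axis i s) ∂(vol N)‖ ≤ C := by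
    intro s
    rw [Real.norm_eq_abs, abs_le]
    refine ⟨?_, hbound g hg hg1 s⟩
    have := hbound (fun x => - g x) (ContDiff.neg hg) (fun x => by rw [abs_neg]; exact hg1 x) s
    have e : ∀ z, pderiv i (fun x => - g x) z = - pderiv i g z := fun z => deriv.fun_neg
    simp only [e, integral_neg] at this
    linarith
  have := (convex_univ (𝕜 := ℝ) (E := ℝ)).norm_image_sub_le_of_norm_hasDerivWithin_le
    (fun s _ => (hg.hasDerivAt_setIntegral i F s).hasDerivWithinAt) (fun s _ => hb2 s)
    (Set.mem_univ 0) (Set.mem_univ t)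
  rw [sub_zero, axis_zero, setIntegral_comp_add] at this
  simp only [add_zero, Real.norm_eq_abs] at this
  exact (le_abs_self _).trans this

theorem _root_.UnitAddCircle.exists_coe_eq_abs_eq_norm (y : UnitAddCircle) :
    ∃ t : ℝ, (t : UnitAddCircle) = y ∧ |t| = ‖y‖ := by
  obtain ⟨x, rfl⟩ := QuotientAddGroup.mk_surjective y
  refine ⟨x - round x, ?_, (UnitAddCircle.norm_eq).symm⟩
  rw [AddCircle.coe_sub, sub_eq_self, AddCircle.coe_eq_zero_iff]
  exact ⟨round x, by simp⟩

/-- A set of perimeter at most `C` moves by at most `C ∑ |vᵢ|` in volume under the translation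
by `v`. -/
theorem real_translate_le {F : Set (Torus N)} (hF : MeasurableSet F) {C : ℝ} (hC0 : 0 ≤ C)
    (hC : perimeter F ≤ ENNReal.ofReal C) (v : Torus N) :
    (vol N).real (translate v F ∆ F) ≤ C * ∑ i, ‖v i‖ := by
  choose t ht hn using fun i => (v i).exists_coe_eq_abs_eq_norm
  have hv : v = ∑ i, axis i (t i) := by
    ext j
    rw [WithLp.ofLp_sum, Finset.sum_apply, Finset.sum_eq_single j]
    · rw [axis_apply_self, ht]
    · intro i _ hij
      exact axis_apply_of_ne hij.symm _
    · simp
  have key : ∀ S : Finset (Fin N), (vol N).real (translate (∑ i ∈ S, axis i (t i)) F ∆ F) ≤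
      C * ∑ i ∈ S, ‖v i‖ := by
    intro S
    induction S using Finset.induction_on with
    | empty => simp
    | insert i S hi ih =>
      rw [Finset.sum_insert hi, Finset.sum_insert hi, mul_add]
      refine (measureReal_symmDiff_le (t := translate (axis i (t i)) F) _ (measure_ne_top _ _)
        (measure_ne_top _ _)).trans ?_
      rw [← translate_translate, ← translate_symmDiff, add_comm]
      refine add_le_add ?_ ?_
      · rw [← hn i]
        exact real_translate_axis_le hF hC0 hC i (t i)
      · rw [measureReal_def, vol_translate]
        exact ih
  have := key Finset.univ
  rwa [← hv] at this

/-! ### Perimeter of boxes, unions and differences -/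

theorem translate_box (v : Torus N) (I : Finset (Fin N)) (s : Torus N) (r : Fin N → ℝ) :
    translate v (box I s r) = box I (s + v) r := by
  ext x
  simp only [translate, box, Set.mem_preimage, Set.mem_ofPred_eq, PiLp.sub_apply, PiLp.add_apply,
    dist_eq_norm]
  simp_rw [sub_sub, add_comm]

theorem _root_.UnitAddCircle.norm_coe_le (t : ℝ) : ‖(t : UnitAddCircle)‖ ≤ |t| := by
  rw [UnitAddCircle.norm_eq]
  simpa using round_le t 0

/-- A box has perimeter at most the total area of its faces. -/
theorem perimeter_box_le (I : Finset (Fin N)) (s : Torus N) {r : Fin N → ℝ}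
    (h0 : ∀ i ∈ I, 0 < r i) (h1 : ∀ i ∈ I, r i ≤ 1 / 2) :
    perimeter (box I s r) ≤ ENNReal.ofReal (∑ i ∈ I, 2 * ∏ j ∈ I.erase i, (2 * r j)) := by
  classical
  have e : ∑ i ∈ I, 2 * ∏ j ∈ I.erase i, (2 * r j) =
      ∑ i, if i ∈ I then 2 * ∏ j ∈ I.erase i, (2 * r j) else 0 := by simp
  have hm : ∀ (s : Torus N) (r : Fin N → ℝ), MeasurableSet (box I s r) := fun s r =>
    (isOpen_box I s r).measurableSet
  have hv : ∀ (s : Torus N) (r : Fin N → ℝ), (∀ i ∈ I, 0 ≤ r i) → (∀ i ∈ I, r i ≤ 1 / 2) →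
      (vol N).real (box I s r) = ∏ i ∈ I, (2 * r i) := by
    intro s r h0 h1
    rw [measureReal_def, vol_box I s h0 h1, ENNReal.toReal_ofReal]
    exact Finset.prod_nonneg fun i hi => by linarith [h0 i hi]
  rw [e]
  refine perimeter_le_of_translate (hm s r) _ fun i => ?_
  by_cases hi : i ∈ I
  · simp only [if_pos hi]
    filter_upwards [Ioo_mem_nhdsGT (by linarith [h0 i hi] : (0 : ℝ) < 2 * r i)] with t ht
    rw [translate_box]
    -- the intersection of the two boxes contains a box that is shorter by `t` in direction `i`
    set r' : Fin N → ℝ := Function.update r i (r i - t / 2) with hr'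
    have hsub : box I (s + axis i (t / 2)) r' ⊆ box I (s + axis i t) r ∩ box I s r := by
      intro x hx
      have hhalf : ‖((t / 2 : ℝ) : UnitAddCircle)‖ ≤ t / 2 := by
        refine (UnitAddCircle.norm_coe_le _).trans (le_of_eq (abs_of_pos ?_))
        linarith [ht.1]
      refine ⟨fun j hj => ?_, fun j hj => ?_⟩
      · have := hx j hj
        by_cases hji : j = i
        · subst hji
          rw [hr', Function.update_self] at this
          have h2 : dist ((s + axis j (t / 2)) j) ((s + axis j t) j) ≤ t / 2 := by
            rw [PiLp.add_apply, PiLp.add_apply, dist_add_left, axis_apply_self, axis_apply_self,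
              dist_eq_norm, ← AddCircle.coe_sub, ← norm_neg, ← AddCircle.coe_neg,
              show -(t / 2 - t) = t / 2 by ring]
            exact hhalf
          linarith [dist_triangle (x j) ((s + axis j (t / 2)) j) ((s + axis j t) j)]
        · rw [hr', Function.update_of_ne hji, PiLp.add_apply, axis_apply_of_ne hji] at this
          rwa [PiLp.add_apply, axis_apply_of_ne hji]
      · have := hx j hj
        by_cases hji : j = i
        · subst hji
          rw [hr', Function.update_self] at this
          have h2 : dist ((s + axis j (t / 2)) j) (s j) ≤ t / 2 := by
            rw [PiLp.add_apply, axis_apply_self, dist_eq_norm, add_sub_cancel_left]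
            exact hhalf
          linarith [dist_triangle (x j) ((s + axis j (t / 2)) j) (s j)]
        · rwa [hr', Function.update_of_ne hji, PiLp.add_apply, axis_apply_of_ne hji,
            add_zero] at this
    have hvol : (vol N).real (box I (s + axis i (t / 2)) r') =
        (2 * r i - t) * ∏ j ∈ I.erase i, (2 * r j) := by
      rw [hv]
      · rw [← Finset.mul_prod_erase _ _ hi, hr', Function.update_self]
        congr 1
        · ring
        · refine Finset.prod_congr rfl fun j hj => ?_
          rw [Function.update_of_ne (Finset.ne_of_mem_erase hj)]
      · intro j hj
        by_cases hji : j = i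
        · subst hji
          rw [hr', Function.update_self]
          linarith [ht.2]
        · rw [hr', Function.update_of_ne hji]
          exact (h0 j hj).le
      · intro j hj
        by_cases hji : j = i
        · subst hji
          rw [hr', Function.update_self]
          linarith [ht.1, h1 j hj]
        · rw [hr', Function.update_of_ne hji]
          exact h1 j hj
    have hA : ∀ s, (vol N).real (box I s r) = 2 * r i * ∏ j ∈ I.erase i, (2 * r j) := by
      intro s
      rw [hv s r (fun j hj => (h0 j hj).le) h1, ← Finset.mul_prod_erase _ _ hi]
    have hle := measureReal_mono (μ := vol N) hsub
    rw [real_symmDiff (hm _ _) (hm _ _)]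
    have d1 := measureReal_inter_add_sdiff (μ := vol N) (s := box I (s + axis i t) r) (hm s r)
    have d2 := measureReal_inter_add_sdiff (μ := vol N) (s := box I s r) (hm (s + axis i t) r)
    rw [Set.inter_comm] at d2
    rw [hA] at d1 d2
    rw [hvol] at hle
    linarith
  · refine Eventually.of_forall fun t => ?_
    have : translate (axis i t) (box I s r) = box I s r := by
      rw [translate_box]
      ext x
      refine forall₂_congr fun j hj => ?_
      rw [PiLp.add_apply, axis_apply_of_ne (by rintro rfl; exact hi hj), add_zero]
    simp [this, hi]

theorem perimeter_union_le {A B : Set (Torus N)} (hB : MeasurableSet B) (h : Disjoint A B) :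
    perimeter (A ∪ B) ≤ perimeter A + perimeter B := by
  refine iSup₂_le fun X hX => ?_
  rw [setIntegral_union h hB (hX.continuous_divergence.integrable_torus A)
    (hX.continuous_divergence.integrable_torus B)]
  exact ENNReal.ofReal_add_le.trans (add_le_add (hX.le_perimeter A) (hX.le_perimeter B))

theorem perimeter_diff_le {A B : Set (Torus N)} (hB : MeasurableSet B) (h : B ⊆ A) :
    perimeter (A \ B) ≤ perimeter A + perimeter B := by
  refine iSup₂_le fun X hX => ?_
  have e : ∫ x in A \ B, divergence X x ∂(vol N) = ∫ x in A, divergence X x ∂(vol N) +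
      ∫ x in B, divergence (fun x => - X x) x ∂(vol N) := by
    simp only [divergence_neg, integral_neg]
    rw [← integral_inter_add_sdiff hB (hX.continuous_divergence.integrable_torus A),
      Set.inter_eq_self_of_subset_right h]
    ring
  rw [e]
  exact ENNReal.ofReal_add_le.trans (add_le_add (hX.le_perimeter A) (hX.neg.le_perimeter B))

theorem perimeter_empty : perimeter (∅ : Set (Torus N)) = 0 := by
  simp [perimeter]

theorem perimeter_biUnion_le {ι : Type*} (S : Finset ι) (Q : ι → Set (Torus N))
    (hQ : ∀ i ∈ S, MeasurableSet (Q i)) (hd : (S : Set ι).PairwiseDisjoint Q) :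
    perimeter (⋃ i ∈ S, Q i) ≤ ∑ i ∈ S, perimeter (Q i) := by
  classical
  induction S using Finset.induction_on with
  | empty => simp [perimeter_empty]
  | insert i S hi ih =>
    rw [Finset.set_biUnion_insert, Set.union_comm, Finset.sum_insert hi, add_comm]
    refine (perimeter_union_le (hQ i (Finset.mem_insert_self i S)) ?_).trans
      (add_le_add (ih (fun j hj => hQ j (Finset.mem_insert_of_mem hj))
        (hd.subset (by simp))) le_rfl)
    rw [Set.disjoint_iUnion₂_left]
    intro j hj
    exact hd (by simp [hj]) (by simp) (by rintro rfl; exact hi hj)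

/-! ### Compactness of sets of bounded perimeter -/

/-- The measurable sets form a complete space for the volume of the symmetric difference. -/
instance _root_.MeasureTheory.MeasuredSets.instCompleteSpace {α : Type*} [MeasurableSpace α]
    {μ : Measure α} : CompleteSpace (MeasuredSets μ) := by
  refine EMetric.complete_of_convergent_controlled_sequences (fun n => (2⁻¹ : ℝ≥0∞) ^ n)
    (fun n => ENNReal.pow_pos (by simp) n) fun u hu => ?_
  have hum : ∀ n, MeasurableSet (u n : Set α) := fun n => (u n).2
  have hLm : MeasurableSet (⋂ n, ⋃ k ≥ n, (u k : Set α)) := MeasurableSet.iInter fun n =>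
    MeasurableSet.iUnion fun k => MeasurableSet.iUnion fun _ => hum k
  obtain ⟨L, hL⟩ : ∃ L : MeasuredSets μ, (L : Set α) = ⋂ n, ⋃ k ≥ n, (u k : Set α) :=
    ⟨⟨_, hLm⟩, rfl⟩
  refine ⟨L, ?_⟩
  rw [tendsto_iff_edist_tendsto_0]
  have hb : ∀ n, edist (u n) L ≤ 2 * (2⁻¹ : ℝ≥0∞) ^ n := by
    intro n
    have hsub : (u n : Set α) ∆ (⋂ n, ⋃ k ≥ n, (u k : Set α)) ⊆
        ⋃ j : ℕ, (u (n + j) : Set α) ∆ u (n + j + 1) := by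
      intro x hx
      by_contra hcon
      simp only [Set.mem_iUnion, not_exists] at hcon
      have hconst : ∀ j, x ∈ (u (n + j) : Set α) ↔ x ∈ (u n : Set α) := by
        intro j
        induction j with
        | zero => rfl
        | succ j ih =>
          rw [← ih]
          have := hcon j
          rw [Set.mem_symmDiff] at this
          rw [← add_assoc]
          tauto
      have hconst' : ∀ k ≥ n, x ∈ (u k : Set α) ↔ x ∈ (u n : Set α) := fun k hk => by
        obtain ⟨j, rfl⟩ := Nat.exists_eq_add_of_le hk
        exact hconst j
      have : x ∈ (⋂ n, ⋃ k ≥ n, (u k : Set α)) ↔ x ∈ (u n : Set α) := by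
        simp only [Set.mem_iInter, Set.mem_iUnion]
        constructor
        · intro h
          obtain ⟨k, hk, hxk⟩ := h n
          exact (hconst' k hk).1 hxk
        · intro h l
          exact ⟨max l n, le_max_left _ _, (hconst' _ (le_max_right _ _)).2 h⟩
      rw [Set.mem_symmDiff] at hx
      tauto
    calc edist (u n) _ ≤ μ (⋃ j : ℕ, (u (n + j) : Set α) ∆ u (n + j + 1)) := by
          rw [MeasuredSets.edist_def, hL]
          exact measure_mono hsub
      _ ≤ ∑' j : ℕ, μ ((u (n + j) : Set α) ∆ u (n + j + 1)) := measure_iUnion_le _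
      _ ≤ ∑' j : ℕ, (2⁻¹ : ℝ≥0∞) ^ (n + j) := ENNReal.tsum_le_tsum fun j =>
          (hu (n + j) (n + j) (n + j + 1) le_rfl (Nat.le_succ _)).le
      _ = 2 * (2⁻¹ : ℝ≥0∞) ^ n := by
          simp_rw [pow_add]
          rw [ENNReal.tsum_mul_left, ENNReal.tsum_geometric, ENNReal.one_sub_inv_two, inv_inv,
            mul_comm]
  refine tendsto_of_tendsto_of_tendsto_of_le_of_le tendsto_const_nhds ?_ (fun _ => zero_le) hb
  have := ENNReal.Tendsto.const_mul (a := 2)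
    (ENNReal.tendsto_pow_atTop_nhds_zero_of_lt_one (r := 2⁻¹) (by simp)) (Or.inr (by simp))
  simpa using this

theorem continuous_setIntegral {g : Torus N → ℝ} (hg : Continuous g) :
    Continuous fun F : MeasuredSets (vol N) => ∫ x in (F : Set (Torus N)), g x ∂(vol N) := by
  obtain ⟨C, hC⟩ := isCompact_univ.exists_bound_of_continuousOn hg.continuousOn
  have hC0 : 0 ≤ C := (norm_nonneg _).trans (hC 0 trivial)
  refine (LipschitzWith.of_dist_le_mul (K := ⟨C, hC0⟩) fun A B => ?_).continuous
  exact abs_setIntegral_sub_setIntegral_le hg (fun x => hC x trivial) A.2 B.2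

/-- The perimeter is lower semicontinuous for the convergence in volume, being a supremum of
continuous functions. -/
theorem lowerSemicontinuous_perimeter :
    LowerSemicontinuous fun F : MeasuredSets (vol N) => perimeter (F : Set (Torus N)) := by
  refine lowerSemicontinuous_iSup fun X => lowerSemicontinuous_iSup fun hX => ?_
  exact (ENNReal.continuous_ofReal.comp
    (continuous_setIntegral hX.continuous_divergence)).lowerSemicontinuous

/-- Fubini's theorem for the set of pairs `(x, z)` such that exactly one of `x`, `x + z` lies in
`F`. -/
theorem lintegral_vol_oscillation_le {W F : Set (Torus N)} (hW : MeasurableSet W)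
    (hF : MeasurableSet F) {κ : ℝ≥0∞}
    (h : ∀ z ∈ W, vol N (translate (-z) F ∆ F) ≤ κ) :
    ∫⁻ x, vol N {z | z ∈ W ∧ x ∈ translate (-z) F ∆ F} ∂(vol N) ≤ vol N W * κ := by
  have hT : MeasurableSet {q : Torus N × Torus N | q.2 ∈ W ∧ q.1 ∈ translate (-q.2) F ∆ F} := by
    refine (measurable_snd hW).inter ?_
    have h1 : MeasurableSet {q : Torus N × Torus N | q.1 - -q.2 ∈ F} :=
      hF.preimage (by fun_prop)
    have h2 : MeasurableSet {q : Torus N × Torus N | q.1 ∈ F} := hF.preimage (by fun_prop)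
    exact h1.symmDiff h2
  have e1 := Measure.prod_apply (μ := vol N) (ν := vol N) hT
  have e2 := Measure.prod_apply_symm (μ := vol N) (ν := vol N) hT
  calc ∫⁻ x, vol N {z | z ∈ W ∧ x ∈ translate (-z) F ∆ F} ∂(vol N)
      = ∫⁻ z, vol N {x | z ∈ W ∧ x ∈ translate (-z) F ∆ F} ∂(vol N) := e1.symm.trans e2
    _ ≤ ∫⁻ z, W.indicator (fun _ => κ) z ∂(vol N) := by
        refine lintegral_mono fun z => ?_
        by_cases hz : z ∈ W
        · simpa [hz] using h z hz
        · simp [hz]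
    _ = vol N W * κ := by rw [lintegral_indicator hW, setLIntegral_const, mul_comm]

/-- Two sets that move little under the translations in `W`, and whose averages over the
translates of `W` are close, are close. -/
theorem vol_mul_symmDiff_le {W F G : Set (Torus N)} (hW : MeasurableSet W)
    (hF : MeasurableSet F) (hG : MeasurableSet G) {κ θ : ℝ≥0∞}
    (h1 : ∀ z ∈ W, vol N (translate (-z) F ∆ F) ≤ κ)
    (h2 : ∀ z ∈ W, vol N (translate (-z) G ∆ G) ≤ κ)
    (h3 : ∀ x, vol N (F ∩ translate x W) ≤ vol N (G ∩ translate x W) + θ)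
    (h4 : ∀ x, vol N (G ∩ translate x W) ≤ vol N (F ∩ translate x W) + θ) :
    vol N W * vol N (F ∆ G) ≤ vol N W * κ + vol N W * κ + θ := by
  -- for `x ∈ A` the part of `x + W` outside `A`, and for `x ∉ A` the part of it inside `A`,
  -- consists of points `x + z` such that the translation by `z` changes the membership in `A`
  have key : ∀ A : Set (Torus N), MeasurableSet A → ∀ x,
      (x ∈ A → vol N W ≤ vol N (A ∩ translate x W) +
        vol N {z | z ∈ W ∧ x ∈ translate (-z) A ∆ A}) ∧
      (x ∉ A → vol N (A ∩ translate x W) ≤ vol N {z | z ∈ W ∧ x ∈ translate (-z) A ∆ A}) := by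
    intro A hA x
    have e : vol N (A ∩ translate x W) = vol N {z | z ∈ W ∧ x + z ∈ A} := by
      rw [← vol_translate (-x) (A ∩ translate x W)]
      congr 1
      ext z
      simp [translate, add_comm, and_comm]
    rw [e]
    constructor
    · intro hx
      refine (measure_mono fun z hz => ?_).trans (measure_union_le _ _)
      by_cases hxz : x + z ∈ A
      · exact Or.inl ⟨hz, hxz⟩
      · refine Or.inr ⟨hz, Or.inr ⟨hx, ?_⟩⟩
        simpa [translate] using hxz
    · intro hx
      refine measure_mono fun z hz => ⟨hz.1, Or.inl ⟨?_, hx⟩⟩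
      simpa [translate] using hz.2
  have hpt : ∀ x ∈ F ∆ G, vol N W ≤ vol N {z | z ∈ W ∧ x ∈ translate (-z) F ∆ F} +
      vol N {z | z ∈ W ∧ x ∈ translate (-z) G ∆ G} + θ := by
    rintro x (⟨hxF, hxG⟩ | ⟨hxG, hxF⟩)
    · refine ((key F hF x).1 hxF).trans ?_
      rw [add_comm, add_assoc]
      exact add_le_add le_rfl ((h3 x).trans (add_le_add ((key G hG x).2 hxG) le_rfl))
    · refine ((key G hG x).1 hxG).trans ?_
      rw [add_comm, add_comm (vol N _) (vol N {z | z ∈ W ∧ x ∈ translate (-z) G ∆ G}), add_assoc]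
      exact add_le_add le_rfl ((h4 x).trans (add_le_add ((key F hF x).2 hxF) le_rfl))
  have hmeas : ∀ A : Set (Torus N), MeasurableSet A →
      Measurable fun x => vol N {z | z ∈ W ∧ x ∈ translate (-z) A ∆ A} := by
    intro A hA
    have hT : MeasurableSet {q : Torus N × Torus N | q.2 ∈ W ∧ q.1 ∈ translate (-q.2) A ∆ A} := by
      refine (measurable_snd hW).inter ?_
      have h1 : MeasurableSet {q : Torus N × Torus N | q.1 - -q.2 ∈ A} :=
        hA.preimage (by fun_prop)
      have h2 : MeasurableSet {q : Torus N × Torus N | q.1 ∈ A} := hA.preimage (by fun_prop)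
      exact h1.symmDiff h2
    exact measurable_measure_prodMk_left hT
  calc vol N W * vol N (F ∆ G) = ∫⁻ _ in F ∆ G, vol N W ∂(vol N) := (setLIntegral_const _ _).symm
    _ ≤ ∫⁻ x in F ∆ G, (vol N {z | z ∈ W ∧ x ∈ translate (-z) F ∆ F} +
          vol N {z | z ∈ W ∧ x ∈ translate (-z) G ∆ G} + θ) ∂(vol N) :=
        setLIntegral_mono' (hF.symmDiff hG) hpt
    _ ≤ ∫⁻ x, (vol N {z | z ∈ W ∧ x ∈ translate (-z) F ∆ F} +
          vol N {z | z ∈ W ∧ x ∈ translate (-z) G ∆ G} + θ) ∂(vol N) :=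
        setLIntegral_le_lintegral _ _
    _ ≤ _ := by
        rw [lintegral_add_right _ measurable_const, lintegral_add_left (hmeas F hF)]
        simp only [lintegral_const, measure_univ, mul_one]
        gcongr
        · exact lintegral_vol_oscillation_le hW hF h1
        · exact lintegral_vol_oscillation_le hW hG h2

theorem sum_norm_apply_le (v : Torus N) : ∑ i, ‖v i‖ ≤ N * ‖v‖ := by
  refine (Finset.sum_le_sum fun i _ => PiLp.norm_apply_le v i).trans ?_
  simp

theorem vol_le_ofReal {A : Set (Torus N)} {a : ℝ} (h : (vol N).real A ≤ a) :
    vol N A ≤ ENNReal.ofReal a := by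
  rw [← ofReal_measureReal]
  exact ENNReal.ofReal_le_ofReal h

/-- The Fréchet–Kolmogorov argument: a set of bounded perimeter is determined up to a small error
by the approximate values of its averages over small cubes centered at finitely many points. -/
theorem totallyBounded_perimeter_le {C : ℝ} (hC : 0 ≤ C) :
    TotallyBounded
      {F : MeasuredSets (vol N) | perimeter (F : Set (Torus N)) ≤ ENNReal.ofReal C} := by
  refine Metric.totallyBounded_of_finite_discretization fun ε hε => ?_
  have hN : (0 : ℝ) ≤ N := N.cast_nonneg
  -- the half-side of the cubes over which averages are taken: translations by their points move the
  -- sets in question by at most `ε / 8`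
  obtain ⟨r, hr0, hr1, hr2⟩ : ∃ r : ℝ, 0 < r ∧ r ≤ 1 / 2 ∧ C * (N * r) ≤ ε / 8 := by
    refine ⟨min (1 / 2) (ε / (8 * (C * N + 1))), by positivity, min_le_left _ _, ?_⟩
    have h1 : min (1 / 2) (ε / (8 * (C * N + 1))) ≤ ε / (8 * (C * N + 1)) := min_le_right _ _
    have hCN : 0 ≤ C * N := by positivity
    rw [le_div_iff₀ (by positivity)] at h1
    have h2 : 0 < min (1 / 2) (ε / (8 * (C * N + 1))) := by positivity
    nlinarith
  set W : Set (Torus N) := box Finset.univ 0 (fun _ => r) with hWdef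
  have hW : MeasurableSet W := (isOpen_box _ _ _).measurableSet
  obtain ⟨c, hc0, hc⟩ : ∃ c : ℝ, 0 ≤ c ∧ perimeter W ≤ ENNReal.ofReal c :=
    ⟨_, by positivity, perimeter_box_le _ _ (fun _ _ => hr0) (fun _ _ => hr1)⟩
  obtain ⟨w, hw0, hw⟩ : ∃ w : ℝ, 0 < w ∧ vol N W = ENNReal.ofReal w :=
    ⟨_, by positivity, vol_box _ _ (fun _ _ => hr0.le) (fun _ _ => hr1)⟩
  -- the mesh of the net of centers; the cube has finite perimeter `c`, so that averages over cubes
  -- with centers at distance `τ` are close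
  obtain ⟨τ, hτ0, hτ⟩ : ∃ τ : ℝ, 0 < τ ∧ c * (N * τ) ≤ w * ε / 6 := by
    refine ⟨w * ε / (6 * (c * N + 1)), by positivity, ?_⟩
    have e : c * (N * (w * ε / (6 * (c * N + 1)))) = w * ε / 6 * (c * N / (c * N + 1)) := by
      field_simp
    rw [e]
    refine mul_le_of_le_one_right (by positivity) ?_
    rw [div_le_one (by positivity)]
    linarith
  -- the averages are recorded up to multiples of `1 / K`
  obtain ⟨K, hK⟩ := exists_nat_gt (6 / (w * ε))
  have hK0 : (0 : ℝ) < K := lt_trans (by positivity) hK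
  have hK1 : 1 / (K : ℝ) ≤ w * ε / 6 := by
    rw [div_lt_iff₀ (by positivity)] at hK
    rw [div_le_iff₀ hK0]
    linarith
  obtain ⟨t, -, htf, htc⟩ := finite_cover_balls_of_compact (isCompact_univ (X := Torus N)) hτ0
  have := htf.fintype
  have hshift : ∀ (F : Set (Torus N)) (x y : Torus N), dist x y < τ →
      (vol N).real (F ∩ translate x W) ≤ (vol N).real (F ∩ translate y W) + w * ε / 6 := by
    intro F x y hxy
    have h1 : (vol N).real (translate x W ∆ translate y W) ≤ w * ε / 6 := by
      have e : translate x W ∆ translate y W = translate y (translate (x - y) W ∆ W) := by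
        rw [translate_symmDiff, translate_translate, add_sub_cancel]
      rw [e, measureReal_def, vol_translate]
      refine (real_translate_le hW hc0 hc (x - y)).trans (le_trans ?_ hτ)
      refine mul_le_mul_of_nonneg_left ((sum_norm_apply_le _).trans ?_) hc0
      rw [← dist_eq_norm]
      exact mul_le_mul_of_nonneg_left hxy.le hN
    have h2 : F ∩ translate x W ⊆ (F ∩ translate y W) ∪ (translate x W ∆ translate y W) := by
      intro z hz
      by_cases h : z ∈ translate y W
      · exact Or.inl ⟨hz.1, h⟩
      · exact Or.inr (Or.inl ⟨hz.2, h⟩)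
    exact (measureReal_mono h2).trans ((measureReal_union_le _ _).trans (by linarith))
  refine ⟨t → Fin (K + 1), inferInstance, fun F x =>
    ⟨⌊K * (vol N).real ((F : MeasuredSets (vol N)) ∩ translate (x : Torus N) W)⌋₊, ?_⟩, ?_⟩
  · rw [Nat.lt_succ_iff]
    refine Nat.floor_le_of_le ?_
    exact mul_le_of_le_one_right hK0.le measureReal_le_one
  rintro ⟨F, hF⟩ ⟨G, hG⟩ hFG
  have hnet : ∀ x ∈ t, |(vol N).real (F ∩ translate x W) - (vol N).real (G ∩ translate x W)| ≤
      w * ε / 6 := by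
    intro x hx
    have h1 := congrFun hFG ⟨x, hx⟩
    simp only [Fin.mk.injEq] at h1
    have h2 := Nat.floor_le (a := K * (vol N).real (F ∩ translate x W)) (by positivity)
    have h3 := Nat.lt_floor_add_one (K * (vol N).real (F ∩ translate x W))
    have h4 := Nat.floor_le (a := K * (vol N).real (G ∩ translate x W)) (by positivity)
    have h5 := Nat.lt_floor_add_one (K * (vol N).real (G ∩ translate x W))
    rw [h1] at h2 h3
    refine le_trans ?_ hK1
    have h6 : |(vol N).real (F ∩ translate x W) - (vol N).real (G ∩ translate x W)| * K =
        |K * (vol N).real (F ∩ translate x W) - K * (vol N).real (G ∩ translate x W)| := by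
      rw [← mul_sub, abs_mul, abs_of_pos hK0, mul_comm]
    rw [le_div_iff₀ hK0, h6, abs_le]
    constructor <;> linarith
  have hclose : ∀ x, |(vol N).real (F ∩ translate x W) - (vol N).real (G ∩ translate x W)| ≤
      w * ε / 2 := by
    intro x
    obtain ⟨y, hy, hxy⟩ := Set.mem_iUnion₂.1 (htc (Set.mem_univ x))
    have h0 := hnet y hy
    have h1 := hshift F x y hxy
    have h2 := hshift F y x (by rwa [dist_comm])
    have h3 := hshift G x y hxy
    have h4 := hshift G y x (by rwa [dist_comm])
    rw [abs_le] at h0 ⊢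
    constructor <;> linarith [h0.1, h0.2]
  have hosc : ∀ F : MeasuredSets (vol N), perimeter (F : Set (Torus N)) ≤ ENNReal.ofReal C →
      ∀ z ∈ W, vol N (translate (-z) F ∆ F) ≤ ENNReal.ofReal (ε / 8) := by
    intro F hF z hz
    refine vol_le_ofReal ((real_translate_le F.2 hC hF (-z)).trans (le_trans ?_ hr2))
    refine mul_le_mul_of_nonneg_left ?_ hC
    refine (Finset.sum_le_sum (g := fun _ => r) fun i _ => ?_).trans (by simp)
    have := hz i (Finset.mem_univ i)
    rw [PiLp.zero_apply, dist_zero_right] at this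
    rw [PiLp.neg_apply, norm_neg]
    exact this.le
  have hav : ∀ (A B : Set (Torus N)) (x : Torus N),
      |(vol N).real (A ∩ translate x W) - (vol N).real (B ∩ translate x W)| ≤ w * ε / 2 →
      vol N (A ∩ translate x W) ≤ vol N (B ∩ translate x W) + ENNReal.ofReal (w * ε / 2) := by
    intro A B x h
    rw [abs_le] at h
    rw [← ofReal_measureReal (s := B ∩ translate x W),
      ← ENNReal.ofReal_add measureReal_nonneg (by positivity)]
    exact vol_le_ofReal (by linarith [h.2])
  have hFm : MeasurableSet (F : Set (Torus N)) := F.2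
  have hGm : MeasurableSet (G : Set (Torus N)) := G.2
  have main := vol_mul_symmDiff_le hW hFm hGm (hosc F hF) (hosc G hG)
    (fun x => hav _ _ x (hclose x)) (fun x => hav _ _ x (by rw [abs_sub_comm]; exact hclose x))
  rw [hw, ← ofReal_measureReal (s := (F : Set (Torus N)) ∆ G), ← ENNReal.ofReal_mul hw0.le,
    ← ENNReal.ofReal_mul hw0.le, ← ENNReal.ofReal_add (by positivity) (by positivity),
    ← ENNReal.ofReal_add (by positivity) (by positivity),
    ENNReal.ofReal_le_ofReal_iff (by positivity)] at main
  have hd : w * (vol N).real ((F : Set (Torus N)) ∆ G) ≤ w * (3 / 4 * ε) := by linarith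
  have := le_of_mul_le_mul_left hd hw0
  change (vol N).real ((F : Set (Torus N)) ∆ G) < ε
  linarith

/-- Sets of bounded perimeter form a compact set for the convergence in volume. -/
theorem isCompact_perimeter_le (C : ℝ≥0) :
    IsCompact {F : MeasuredSets (vol N) | perimeter (F : Set (Torus N)) ≤ C} := by
  refine isCompact_iff_totallyBounded_isComplete.2 ⟨?_,
    (lowerSemicontinuous_perimeter.isClosed_preimage _).isComplete⟩
  have := totallyBounded_perimeter_le (N := N) C.2
  rwa [ENNReal.ofReal_eq_coe_nnreal C.2] at this

/-! ### Strips and cubes -/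

/-- The open strip of half-width `r` about the hyperplane `xᵢ = 0`. -/
def strip (i : Fin N) (r : ℝ) : Set (Torus N) := {x | ‖x i‖ < r}

/-- The open cube of half-side `ρ` about `s`. -/
def cube (s : Torus N) (ρ : ℝ) : Set (Torus N) := box Finset.univ s fun _ => ρ

/-- The closed cube of half-side `ρ` about `s`. -/
def closedCube (s : Torus N) (ρ : ℝ) : Set (Torus N) := {x | ∀ j, dist (x j) (s j) ≤ ρ}

theorem mem_cube {s x : Torus N} {ρ : ℝ} : x ∈ cube s ρ ↔ ∀ j, dist (x j) (s j) < ρ := by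
  simp [cube, box]

theorem strip_eq_box (i : Fin N) (r : ℝ) : strip i r = box {i} 0 fun _ => r := by
  ext x
  simp [strip, box]

theorem isOpen_strip (i : Fin N) (r : ℝ) : IsOpen (strip i r) := by
  rw [strip_eq_box]
  exact isOpen_box _ _ _

theorem isOpen_cube (s : Torus N) (ρ : ℝ) : IsOpen (cube s ρ) := isOpen_box _ _ _

theorem isClosed_closedCube (s : Torus N) (ρ : ℝ) : IsClosed (closedCube s ρ) := by
  have : closedCube s ρ = ⋂ j, {x | dist (x j) (s j) ≤ ρ} := by
    ext x
    simp [closedCube]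
  rw [this]
  exact isClosed_iInter fun j => isClosed_le (by fun_prop) continuous_const

theorem cube_subset_closedCube (s : Torus N) (ρ : ℝ) : cube s ρ ⊆ closedCube s ρ :=
  fun _ hx j => (mem_cube.1 hx j).le

theorem vol_strip (i : Fin N) {r : ℝ} (h0 : 0 ≤ r) (h1 : r ≤ 1 / 2) :
    vol N (strip i r) = ENNReal.ofReal (2 * r) := by
  rw [strip_eq_box, vol_box _ _ (fun _ _ => h0) (fun _ _ => h1)]
  simp

theorem perimeter_strip_le (i : Fin N) {r : ℝ} (h0 : 0 < r) (h1 : r ≤ 1 / 2) :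
    perimeter (strip i r) ≤ ENNReal.ofReal 2 := by
  rw [strip_eq_box]
  refine (perimeter_box_le _ _ (fun _ _ => h0) (fun _ _ => h1)).trans (le_of_eq ?_)
  simp

theorem vol_cube (s : Torus N) {ρ : ℝ} (h0 : 0 ≤ ρ) (h1 : ρ ≤ 1 / 2) :
    vol N (cube s ρ) = ENNReal.ofReal ((2 * ρ) ^ N) := by
  rw [cube, vol_box _ _ (fun _ _ => h0) (fun _ _ => h1)]
  simp

theorem vol_closedCube_le (s : Torus N) {ρ : ℝ} (h0 : 0 ≤ ρ) :
    vol N (closedCube s ρ) ≤ ENNReal.ofReal ((2 * ρ) ^ N) := by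
  have h := vol_pi (N := N) (fun j => Metric.closedBall (s j) ρ)
  have e : closedCube s ρ = {x : Torus N | ∀ j, x j ∈ Metric.closedBall (s j) ρ} := rfl
  rw [e, h]
  simp_rw [AddCircle.volume_closedBall]
  rw [Finset.prod_const, Finset.card_univ, Fintype.card_fin, ENNReal.ofReal_pow (by linarith)]
  exact pow_le_pow_left' (ENNReal.ofReal_le_ofReal (min_le_right _ _)) _

theorem cube_ae_eq_closedCube (s : Torus N) {ρ : ℝ} (h0 : 0 ≤ ρ) (h1 : ρ ≤ 1 / 2) :
    cube s ρ =ᵐ[vol N] closedCube s ρ := by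
  refine ae_eq_of_subset_of_measure_ge (cube_subset_closedCube s ρ) ?_
    (isOpen_cube s ρ).measurableSet.nullMeasurableSet (measure_ne_top _ _)
  rw [vol_cube s h0 h1]
  exact vol_closedCube_le s h0

theorem perimeter_cube_le (s : Torus N) {ρ : ℝ} (h0 : 0 < ρ) (h1 : ρ ≤ 1 / 2) :
    perimeter (cube s ρ) ≤ ENNReal.ofReal (N * (2 * (2 * ρ) ^ (N - 1))) := by
  refine (perimeter_box_le _ _ (fun _ _ => h0) (fun _ _ => h1)).trans (le_of_eq ?_)
  simp

theorem dist_le_of_forall_dist_le {x y : Torus N} {ρ : ℝ} (h : ∀ j, dist (x j) (y j) ≤ ρ) :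
    dist x y ≤ N * ρ := by
  have h1 : ‖x - y‖ ≤ ∑ j, ‖(x - y) j‖ := by
    refine abs_le_of_sq_le_sq' ?_ (Finset.sum_nonneg fun _ _ => norm_nonneg _) |>.2
    rw [PiLp.norm_sq_eq_of_L2]
    exact Finset.sum_sq_le_sq_sum_of_nonneg fun _ _ => norm_nonneg _
  rw [dist_eq_norm]
  refine h1.trans ((Finset.sum_le_sum (g := fun _ => ρ) fun j _ => ?_).trans (by simp))
  rw [PiLp.sub_apply, ← dist_eq_norm]
  exact h j

theorem dist_apply_le (x y : Torus N) (j : Fin N) : dist (x j) (y j) ≤ dist x y := by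
  rw [dist_eq_norm, dist_eq_norm, ← PiLp.sub_apply]
  exact PiLp.norm_apply_le _ j

/-! ### Lebesgue representatives -/

theorem cube_subset_ball {x z : Torus N} {t r : ℝ} (h : ∀ j, dist (z j) (x j) ≤ t)
    (ht : 2 * N * t < r) : cube z t ⊆ Metric.ball x r := by
  intro y hy
  have : dist y x ≤ N * (t + t) := dist_le_of_forall_dist_le fun j =>
    (dist_triangle _ (z j) _).trans (add_le_add (mem_cube.1 hy j).le (h j))
  rw [Metric.mem_ball]
  linarith

theorem vol_ball_pos (x : Torus N) {r : ℝ} (hr : 0 < r) : 0 < vol N (Metric.ball x r) := by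
  have hN : (0 : ℝ) ≤ N := N.cast_nonneg
  set t := min (1 / 2) (r / (2 * N + 1)) with ht
  have ht0 : 0 < t := by positivity
  have h1 : t ≤ r / (2 * N + 1) := min_le_right _ _
  rw [le_div_iff₀ (by positivity)] at h1
  refine lt_of_lt_of_le ?_ (measure_mono (cube_subset_ball (z := x) (t := t)
    (fun j => by simpa using ht0.le) (by linarith)))
  rw [vol_cube x ht0.le (min_le_left _ _)]
  positivity

theorem ball_subset_closedCube (x : Torus N) (r : ℝ) : Metric.ball x r ⊆ closedCube x r :=
  fun y hy j => (dist_apply_le y x j).trans (le_of_lt hy)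

/-- A point near which the complement of `G` contains cubes of comparable size at every small
scale is not a point of density one of `G`. -/
theorem notMem_lebesgueRep {G : Set (Torus N)} {x : Torus N}
    (h : ∀ᶠ t in 𝓝[>] (0 : ℝ), ∃ z : Torus N, (∀ j, dist (z j) (x j) ≤ t) ∧ cube z t ⊆ Gᶜ) :
    x ∉ lebesgueRep G := by
  intro hx
  have hx : Tendsto (fun r : ℝ => vol N (G ∩ Metric.ball x r) / vol N (Metric.ball x r))
    (𝓝[>] 0) (𝓝 1) := hx
  have hN : (0 : ℝ) ≤ N := N.cast_nonneg
  -- the ball of radius `r` lies in a cube of half-side `r` and contains the cube of half-side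
  -- `r / (2 * N + 1)` about `z`, which misses `G`
  set κ : ℝ := ((2 * N + 1 : ℝ)⁻¹) ^ N with hκ
  have hκ0 : 0 < κ := by positivity
  have hlim : Tendsto (fun r : ℝ => r / (2 * N + 1)) (𝓝[>] 0) (𝓝[>] 0) := by
    refine tendsto_nhdsWithin_iff.2 ⟨?_, ?_⟩
    · have : Tendsto (fun r : ℝ => r / (2 * N + 1)) (𝓝 0) (𝓝 (0 / (2 * N + 1))) :=
        tendsto_id.div_const _
      rw [zero_div] at this
      exact this.mono_left nhdsWithin_le_nhds
    · filter_upwards [self_mem_nhdsWithin] with r hr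
      have hr : 0 < r := hr
      exact Set.mem_Ioi.2 (by positivity)
  have hev : ∀ᶠ r in 𝓝[>] (0 : ℝ),
      vol N (G ∩ Metric.ball x r) / vol N (Metric.ball x r) ≤ ENNReal.ofReal (1 - κ) := by
    filter_upwards [hlim.eventually h, Ioo_mem_nhdsGT (by norm_num : (0 : ℝ) < 1 / 2)] with r hr hr2
    obtain ⟨z, hz, hzG⟩ := hr
    have hr0 : 0 < r := hr2.1
    have ht0 : 0 < r / (2 * N + 1) := by positivity
    have htr : r / (2 * N + 1) ≤ r := div_le_self hr0.le (by linarith)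
    have hsub : cube z (r / (2 * N + 1)) ⊆ Metric.ball x r := by
      refine cube_subset_ball hz ?_
      rw [← mul_div_assoc, div_lt_iff₀ (by positivity)]
      nlinarith
    have hcube : (vol N).real (cube z (r / (2 * N + 1))) = κ * (2 * r) ^ N := by
      rw [measureReal_def, vol_cube _ ht0.le (by linarith [hr2.2]),
        ENNReal.toReal_ofReal (by positivity), hκ, ← mul_pow]
      congr 1
      field_simp
    have hball : (vol N).real (Metric.ball x r) ≤ (2 * r) ^ N :=
      ENNReal.toReal_le_of_le_ofReal (by positivity)
        ((measure_mono (ball_subset_closedCube x r)).trans (vol_closedCube_le x hr0.le))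
    have hdisj : Disjoint (G ∩ Metric.ball x r) (cube z (r / (2 * N + 1))) :=
      Set.disjoint_left.2 fun y hy hyc => hzG hyc hy.1
    have hadd : (vol N).real (G ∩ Metric.ball x r) + (vol N).real (cube z (r / (2 * N + 1))) ≤
        (vol N).real (Metric.ball x r) := by
      rw [← measureReal_union hdisj (isOpen_cube _ _).measurableSet]
      exact measureReal_mono (Set.union_subset Set.inter_subset_right hsub)
    refine ENNReal.div_le_of_le_mul ?_
    rw [← ofReal_measureReal (s := Metric.ball x r), ← ENNReal.ofReal_mul']
    · refine vol_le_ofReal ?_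
      rw [hcube] at hadd
      nlinarith
    · exact measureReal_nonneg
  have h1 : (1 : ℝ≥0∞) ≤ ENNReal.ofReal (1 - κ) := le_of_tendsto hx hev
  rw [ENNReal.one_le_ofReal] at h1
  linarith

/-- An open set is its own Lebesgue representative when its complement is thick near each of its
points. -/
theorem lebesgueRep_eq_self {G : Set (Torus N)} (hG : IsOpen G)
    (h : ∀ x ∉ G, ∀ᶠ t in 𝓝[>] (0 : ℝ), ∃ z : Torus N,
      (∀ j, dist (z j) (x j) ≤ t) ∧ cube z t ⊆ Gᶜ) :
    lebesgueRep G = G := by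
  refine Set.Subset.antisymm (fun x hx => ?_) fun x hx => ?_
  · by_contra hxG
    exact notMem_lebesgueRep (h x hxG) hx
  · obtain ⟨ε, hε, hsub⟩ := Metric.isOpen_iff.1 hG x hx
    refine tendsto_const_nhds.congr' ?_
    filter_upwards [Ioo_mem_nhdsGT hε] with r hr
    rw [Set.inter_eq_self_of_subset_right ((Metric.ball_subset_ball hr.2.le).trans hsub),
      ENNReal.div_self (vol_ball_pos x hr.1).ne' (measure_ne_top _ _)]

theorem _root_.UnitAddCircle.norm_coe_eq_abs {t : ℝ} (h : |t| ≤ 1 / 2) :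
    ‖(t : UnitAddCircle)‖ = |t| := by
  rw [AddCircle.norm_coe_eq_abs_iff 1 one_ne_zero]
  simpa using h

/-- In the circle, a point of a closed arc lies at distance at most `t` from a point at depth `t`
inside the arc. -/
theorem _root_.UnitAddCircle.exists_dist_le_sub {x s : UnitAddCircle} {ρ t : ℝ} (hρ : 0 < ρ)
    (h : dist x s ≤ ρ) (ht0 : 0 ≤ t) (ht : t ≤ ρ) :
    ∃ z : UnitAddCircle, dist z x ≤ t ∧ dist z s ≤ ρ - t := by
  obtain ⟨u, hu, hn⟩ := (x - s).exists_coe_eq_abs_eq_norm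
  rw [← dist_eq_norm] at hn
  have hx : x = s + (u : UnitAddCircle) := by rw [hu, add_sub_cancel]
  have h1 : 0 ≤ t / ρ := by positivity
  have h2 : t / ρ ≤ 1 := (div_le_one hρ).2 ht
  have h3 : t / ρ * ρ = t := div_mul_cancel₀ t hρ.ne'
  refine ⟨s + ((1 - t / ρ) * u : ℝ), ?_, ?_⟩
  · rw [hx, dist_add_left, dist_eq_norm, ← AddCircle.coe_sub]
    refine (UnitAddCircle.norm_coe_le _).trans ?_
    rw [show (1 - t / ρ) * u - u = -(t / ρ * u) by ring, abs_neg, abs_mul, abs_of_nonneg h1, hn]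
    nlinarith
  · rw [dist_eq_norm, add_sub_cancel_left]
    refine (UnitAddCircle.norm_coe_le _).trans ?_
    rw [abs_mul, abs_of_nonneg (by linarith), hn]
    nlinarith

/-- In the circle, a point outside an open arc lies at distance at most `t` from a point at
depth `t` outside the arc, for all small `t`. -/
theorem _root_.UnitAddCircle.eventually_exists_add_le_dist {x s : UnitAddCircle} {ρ : ℝ}
    (hρ : 0 < ρ) (hρ1 : ρ < 1 / 2) (h : ρ ≤ dist x s) :
    ∀ᶠ t in 𝓝[>] (0 : ℝ), ∃ z : UnitAddCircle, dist z x ≤ t ∧ ρ + t ≤ dist z s := by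
  rcases h.eq_or_lt with h | h
  · obtain ⟨u, hu, hn⟩ := (x - s).exists_coe_eq_abs_eq_norm
    rw [← dist_eq_norm, ← h] at hn
    have hx : x = s + (u : UnitAddCircle) := by rw [hu, add_sub_cancel]
    filter_upwards [Ioo_mem_nhdsGT (by linarith : (0 : ℝ) < 1 / 2 - ρ)] with t ht
    have ht0 : 0 < t := ht.1
    have h3 : t / ρ * ρ = t := div_mul_cancel₀ t hρ.ne'
    have h1 : 0 ≤ t / ρ := by positivity
    refine ⟨s + ((1 + t / ρ) * u : ℝ), ?_, ?_⟩
    · rw [hx, dist_add_left, dist_eq_norm, ← AddCircle.coe_sub]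
      refine (UnitAddCircle.norm_coe_le _).trans ?_
      rw [show (1 + t / ρ) * u - u = t / ρ * u by ring, abs_mul, abs_of_nonneg h1, hn, h3]
    · have e : |(1 + t / ρ) * u| = ρ + t := by
        rw [abs_mul, abs_of_nonneg (by linarith), hn]
        linarith
      rw [dist_eq_norm, add_sub_cancel_left, UnitAddCircle.norm_coe_eq_abs, e]
      rw [e]
      linarith [ht.2]
  · filter_upwards [Ioo_mem_nhdsGT (by linarith : (0 : ℝ) < dist x s - ρ)] with t ht
    exact ⟨x, by simpa using ht.1.le, by linarith [ht.2]⟩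

theorem eventually_exists_cube_subset_closedCube {s x : Torus N} {ρ : ℝ} (hρ : 0 < ρ)
    (hx : x ∈ closedCube s ρ) :
    ∀ᶠ t in 𝓝[>] (0 : ℝ), ∃ z : Torus N, (∀ j, dist (z j) (x j) ≤ t) ∧
      cube z t ⊆ closedCube s ρ := by
  filter_upwards [Ioo_mem_nhdsGT hρ] with t ht
  choose z hz1 hz2 using fun j =>
    UnitAddCircle.exists_dist_le_sub hρ (hx j) ht.1.le ht.2.le
  refine ⟨WithLp.toLp 2 z, hz1, fun y hy j => ?_⟩
  have := dist_triangle (y j) (z j) (s j)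
  have h2 : dist (y j) (z j) < t := mem_cube.1 hy j
  linarith [hz2 j]

theorem eventually_exists_cube_subset_le_dist {x : Torus N} {ρ : ℝ} (hρ : 0 < ρ)
    (hρ1 : ρ < 1 / 2) {i : Fin N} {c : UnitAddCircle} (hx : ρ ≤ dist (x i) c) :
    ∀ᶠ t in 𝓝[>] (0 : ℝ), ∃ z : Torus N, (∀ j, dist (z j) (x j) ≤ t) ∧
      cube z t ⊆ {y | ρ ≤ dist (y i) c} := by
  filter_upwards [UnitAddCircle.eventually_exists_add_le_dist hρ hρ1 hx, self_mem_nhdsWithin]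
    with t ⟨w, hw1, hw2⟩ ht
  have ht : 0 < t := ht
  refine ⟨WithLp.toLp 2 (Function.update (fun j => x j) i w), fun j => ?_, fun y hy => ?_⟩
  · by_cases hj : j = i
    · subst hj
      simpa using hw1
    · simpa [hj] using ht.le
  · have h1 := mem_cube.1 hy i
    simp only [Function.update_self] at h1
    have h2 := dist_triangle w (y i) c
    rw [dist_comm w (y i)] at h2
    exact Set.mem_ofPred_eq ▸ (by linarith)

theorem eventually_cube_subset {x : Torus N} {V : Set (Torus N)} (hV : V ∈ 𝓝 x) :
    ∀ᶠ t in 𝓝[>] (0 : ℝ), ∀ z : Torus N, (∀ j, dist (z j) (x j) ≤ t) → cube z t ⊆ V := by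
  obtain ⟨ε, hε, hsub⟩ := Metric.mem_nhds_iff.1 hV
  have hN : (0 : ℝ) ≤ N := N.cast_nonneg
  filter_upwards [Ioo_mem_nhdsGT (by positivity : 0 < ε / (2 * N + 1))] with t ht z hz
  refine (cube_subset_ball hz ?_).trans hsub
  have := ht.2
  rw [lt_div_iff₀ (by positivity)] at this
  linarith [ht.1]

/-! ### Perforated strips -/

/-- The data of a perforation of the strip of half-width `r` by cubes of half-side `ρ` about the
points of a finite set `S`: the closed cubes are disjoint and do not meet the boundary of the
strip. -/
structure IsPerforation (i : Fin N) (r : ℝ) (S : Finset (Torus N)) (ρ : ℝ) : Prop where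
  pos : 0 < ρ
  lt : ρ < 1 / 4
  strip_pos : 0 < r
  strip_lt : r < 1 / 2
  away : ∀ s ∈ S, ρ < |‖s i‖ - r|
  disjoint : (S : Set (Torus N)).PairwiseDisjoint fun s => closedCube s ρ

/-- The strip of half-width `r`, with the closed cubes about the points of `S` inside the strip
removed, and the open cubes about the points of `S` outside the strip added. -/
def perforated (i : Fin N) (r : ℝ) (S : Finset (Torus N)) (ρ : ℝ) : Set (Torus N) :=
  (strip i r \ ⋃ s ∈ S.filter (fun s => ‖s i‖ < r), closedCube s ρ) ∪
    ⋃ s ∈ S.filter (fun s => ¬ ‖s i‖ < r), cube s ρ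

theorem abs_norm_sub_norm_le_of_mem {s x : Torus N} {ρ : ℝ} (hx : x ∈ closedCube s ρ)
    (i : Fin N) : |‖x i‖ - ‖s i‖| ≤ ρ :=
  (abs_norm_sub_norm_le _ _).trans (by rw [← dist_eq_norm]; exact hx i)

theorem isOpen_perforated (i : Fin N) (r : ℝ) (S : Finset (Torus N)) (ρ : ℝ) :
    IsOpen (perforated i r S ρ) := by
  refine IsOpen.union ?_ (isOpen_biUnion fun s _ => isOpen_cube s ρ)
  exact (isOpen_strip i r).sdiff
    (isClosed_biUnion_finset fun s _ => isClosed_closedCube s ρ)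

namespace IsPerforation

variable {i : Fin N} {r : ℝ} {S : Finset (Torus N)} {ρ : ℝ}

theorem closedCube_subset_strip (h : IsPerforation i r S ρ) {s : Torus N} (hs : s ∈ S)
    (hsr : ‖s i‖ < r) : closedCube s ρ ⊆ strip i r := by
  intro x hx
  have h1 := h.away s hs
  have h2 := abs_norm_sub_norm_le_of_mem hx i
  rw [abs_of_neg (by linarith)] at h1
  rw [abs_le] at h2
  change ‖x i‖ < r
  linarith [h2.2]

theorem lt_norm_of_mem_closedCube (h : IsPerforation i r S ρ) {s : Torus N} (hs : s ∈ S)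
    (hsr : ¬ ‖s i‖ < r) {x : Torus N} (hx : x ∈ closedCube s ρ) : r < ‖x i‖ := by
  have h1 := h.away s hs
  have h2 := abs_norm_sub_norm_le_of_mem hx i
  rw [abs_of_nonneg (by linarith)] at h1
  rw [abs_le] at h2
  linarith [h2.1]

theorem eq_of_mem_closedCube (h : IsPerforation i r S ρ) {s s' x : Torus N} (hs : s ∈ S)
    (hs' : s' ∈ S) (hx : x ∈ closedCube s ρ) (hx' : x ∈ closedCube s' ρ) : s = s' := by
  by_contra hne
  exact Set.disjoint_left.1 (h.disjoint hs hs' hne) hx hx'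

/-- Inside the strip, the perforated strip is the complement of the closed cubes. -/
theorem mem_perforated_of_lt (h : IsPerforation i r S ρ) {x : Torus N} (hx : ‖x i‖ < r) :
    x ∈ perforated i r S ρ ↔ ∀ s ∈ S, x ∉ closedCube s ρ := by
  constructor
  · rintro (⟨-, hx2⟩ | hx2) s hs hxs
    · simp only [Set.mem_iUnion, not_exists, Finset.mem_filter] at hx2
      refine hx2 s ⟨hs, ?_⟩ hxs
      by_contra hsr
      exact absurd (h.lt_norm_of_mem_closedCube hs hsr hxs) (by linarith)
    · obtain ⟨s', hs', hxs'⟩ := Set.mem_iUnion₂.1 hx2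
      rw [Finset.mem_filter] at hs'
      exact absurd (h.lt_norm_of_mem_closedCube hs'.1 hs'.2 (cube_subset_closedCube _ _ hxs'))
        (by linarith)
  · intro hS
    refine Or.inl ⟨hx, ?_⟩
    simp only [Set.mem_iUnion, not_exists, Finset.mem_filter]
    exact fun s hs => hS s hs.1

/-- Outside the strip, the perforated strip is the union of the open cubes. -/
theorem mem_perforated_of_le (h : IsPerforation i r S ρ) {x : Torus N} (hx : r ≤ ‖x i‖) :
    x ∈ perforated i r S ρ ↔ ∃ s ∈ S, x ∈ cube s ρ := by
  constructor
  · rintro (⟨hx1, -⟩ | hx2)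
    · exact absurd hx1 (not_lt.2 hx)
    · obtain ⟨s, hs, hxs⟩ := Set.mem_iUnion₂.1 hx2
      exact ⟨s, (Finset.mem_filter.1 hs).1, hxs⟩
  · rintro ⟨s, hs, hxs⟩
    refine Or.inr (Set.mem_iUnion₂.2 ⟨s, Finset.mem_filter.2 ⟨hs, fun hsr => ?_⟩, hxs⟩)
    exact absurd (h.closedCube_subset_strip hs hsr (cube_subset_closedCube _ _ hxs))
      (not_lt.2 hx)

theorem symmDiff_subset :
    perforated i r S ρ ∆ strip i r ⊆ ⋃ s ∈ S, closedCube s ρ := by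
  rintro x (⟨⟨hx1, -⟩ | hx1, hx2⟩ | ⟨hx1, hx2⟩)
  · exact absurd hx1 hx2
  · obtain ⟨s, hs, hxs⟩ := Set.mem_iUnion₂.1 hx1
    exact Set.mem_iUnion₂.2 ⟨s, (Finset.mem_filter.1 hs).1, cube_subset_closedCube _ _ hxs⟩
  · by_contra hcon
    refine hx2 (Or.inl ⟨hx1, fun hx3 => hcon ?_⟩)
    obtain ⟨s, hs, hxs⟩ := Set.mem_iUnion₂.1 hx3
    exact Set.mem_iUnion₂.2 ⟨s, (Finset.mem_filter.1 hs).1, hxs⟩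

theorem vol_biUnion_closedCube_le (h : IsPerforation i r S ρ) :
    (vol N).real (⋃ s ∈ S, closedCube s ρ) ≤ S.card * (2 * ρ) ^ N := by
  refine (measureReal_biUnion_finset_le _ _).trans ?_
  refine (Finset.sum_le_sum (g := fun _ => (2 * ρ) ^ N) fun s _ => ?_).trans (by simp)
  exact ENNReal.toReal_le_of_le_ofReal (by have := h.pos; positivity)
    (vol_closedCube_le s h.pos.le)

theorem vol_real_perforated (h : IsPerforation i r S ρ) :
    (vol N).real (perforated i r S ρ) = 2 * r
      - (S.filter (fun s => ‖s i‖ < r)).card * (2 * ρ) ^ N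
      + (S.filter (fun s => ¬ ‖s i‖ < r)).card * (2 * ρ) ^ N := by
  have hρ := h.pos
  have hρ' := h.lt
  have hcube : ∀ s : Torus N, (vol N).real (cube s ρ) = (2 * ρ) ^ N := fun s => by
    rw [measureReal_def, vol_cube s hρ.le (by linarith), ENNReal.toReal_ofReal (by positivity)]
  have hccube : ∀ s : Torus N, (vol N).real (closedCube s ρ) = (2 * ρ) ^ N := fun s => by
    rw [← hcube s]
    exact (measureReal_congr (cube_ae_eq_closedCube s hρ.le (by linarith))).symm
  rw [perforated, measureReal_union (h₁ := measure_ne_top _ _) (h₂ := measure_ne_top _ _)]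
  · rw [measureReal_sdiff, measureReal_biUnion_finset, measureReal_biUnion_finset]
    · simp only [hcube, hccube, Finset.sum_const, nsmul_eq_mul]
      rw [measureReal_def, vol_strip i h.strip_pos.le h.strip_lt.le, ENNReal.toReal_ofReal]
      linarith [h.strip_pos]
    · intro s hs s' hs' hne
      exact (h.disjoint (Finset.mem_filter.1 hs).1 (Finset.mem_filter.1 hs').1 hne).mono
        (cube_subset_closedCube s ρ) (cube_subset_closedCube s' ρ)
    · exact fun s _ => (isOpen_cube s ρ).measurableSet
    · intro s hs s' hs' hne
      exact h.disjoint (Finset.mem_filter.1 hs).1 (Finset.mem_filter.1 hs').1 hne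
    · exact fun s _ => (isClosed_closedCube s ρ).measurableSet
    · refine Set.iUnion₂_subset fun s hs => ?_
      exact h.closedCube_subset_strip (Finset.mem_filter.1 hs).1 (Finset.mem_filter.1 hs).2
    · exact (isClosed_biUnion_finset fun s _ => isClosed_closedCube s ρ).measurableSet
  · rw [Set.disjoint_left]
    rintro x ⟨hx1, -⟩ hx2
    obtain ⟨s, hs, hxs⟩ := Set.mem_iUnion₂.1 hx2
    have hx1 : ‖x i‖ < r := hx1
    linarith [h.lt_norm_of_mem_closedCube (Finset.mem_filter.1 hs).1 (Finset.mem_filter.1 hs).2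
      (cube_subset_closedCube _ _ hxs)]
  · exact (isOpen_biUnion fun s _ => isOpen_cube s ρ).measurableSet

theorem perimeter_perforated_le (h : IsPerforation i r S ρ) :
    perimeter (perforated i r S ρ) ≤
      ENNReal.ofReal (2 + S.card * (N * (2 * (2 * ρ) ^ (N - 1)))) := by
  have hρ := h.pos
  have hρ' := h.lt
  have hp0 : 0 ≤ N * (2 * (2 * ρ) ^ (N - 1)) := by positivity
  have hcc : ∀ s : Torus N, perimeter (closedCube s ρ) ≤
      ENNReal.ofReal (N * (2 * (2 * ρ) ^ (N - 1))) := fun s => by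
    rw [← perimeter_congr (cube_ae_eq_closedCube s hρ.le (by linarith))]
    exact perimeter_cube_le s hρ (by linarith)
  have hsum : ∀ (S : Finset (Torus N)) (Q : Torus N → Set (Torus N)),
      (∀ s, perimeter (Q s) ≤ ENNReal.ofReal (N * (2 * (2 * ρ) ^ (N - 1)))) →
      ∑ s ∈ S, perimeter (Q s) ≤ ENNReal.ofReal (S.card * (N * (2 * (2 * ρ) ^ (N - 1)))) := by
    intro S Q hQ
    rw [ENNReal.ofReal_mul (by positivity), ENNReal.ofReal_natCast, ← nsmul_eq_mul]
    exact Finset.sum_le_card_nsmul _ _ _ fun s _ => hQ s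
  have hmeas1 : MeasurableSet (⋃ s ∈ S.filter (fun s => ‖s i‖ < r), closedCube s ρ) :=
    (isClosed_biUnion_finset fun s _ => isClosed_closedCube s ρ).measurableSet
  have hmeas2 : MeasurableSet (⋃ s ∈ S.filter (fun s => ¬ ‖s i‖ < r), cube s ρ) :=
    (isOpen_biUnion fun s _ => isOpen_cube s ρ).measurableSet
  refine (perimeter_union_le hmeas2 ?_).trans ?_
  · rw [Set.disjoint_left]
    rintro x ⟨hx1, -⟩ hx2
    obtain ⟨s, hs, hxs⟩ := Set.mem_iUnion₂.1 hx2
    have hx1 : ‖x i‖ < r := hx1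
    linarith [h.lt_norm_of_mem_closedCube (Finset.mem_filter.1 hs).1 (Finset.mem_filter.1 hs).2
      (cube_subset_closedCube _ _ hxs)]
  · refine (add_le_add ((perimeter_diff_le hmeas1 ?_).trans (add_le_add
      (perimeter_strip_le i h.strip_pos h.strip_lt.le)
      ((perimeter_biUnion_le _ _ ?_ ?_).trans (hsum _ _ hcc))))
      ((perimeter_biUnion_le _ _ ?_ ?_).trans
        (hsum _ _ fun s => perimeter_cube_le s hρ (by linarith)))).trans ?_
    · refine Set.iUnion₂_subset fun s hs => ?_
      exact h.closedCube_subset_strip (Finset.mem_filter.1 hs).1 (Finset.mem_filter.1 hs).2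
    · exact fun s _ => (isClosed_closedCube s ρ).measurableSet
    · intro s hs s' hs' hne
      exact h.disjoint (Finset.mem_filter.1 hs).1 (Finset.mem_filter.1 hs').1 hne
    · exact fun s _ => (isOpen_cube s ρ).measurableSet
    · intro s hs s' hs' hne
      exact (h.disjoint (Finset.mem_filter.1 hs).1 (Finset.mem_filter.1 hs').1 hne).mono
        (cube_subset_closedCube s ρ) (cube_subset_closedCube s' ρ)
    · rw [← ENNReal.ofReal_add (by positivity) (by positivity),
        ← ENNReal.ofReal_add (by positivity) (by positivity), add_assoc, ← add_mul,
        ← Nat.cast_add, Finset.card_filter_add_card_filter_not]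

/-- The complement of the perforated strip is thick near each of its points: such a point lies in a
closed cube inside the strip, or in the complement of an open cube or of the strip. -/
theorem lebesgueRep_perforated (h : IsPerforation i r S ρ) :
    lebesgueRep (perforated i r S ρ) = perforated i r S ρ := by
  have hρ := h.pos
  have hρ' := h.lt
  refine lebesgueRep_eq_self (isOpen_perforated i r S ρ) fun x hx => ?_
  rcases lt_or_ge ‖x i‖ r with hxr | hxr
  · rw [h.mem_perforated_of_lt hxr] at hx
    push Not at hx
    obtain ⟨s, hs, hxs⟩ := hx
    filter_upwards [eventually_exists_cube_subset_closedCube hρ hxs,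
      eventually_cube_subset ((isOpen_strip i r).mem_nhds hxr)] with t ⟨z, hz, hzs⟩ ht
    refine ⟨z, hz, fun y hy hyG => ?_⟩
    rw [h.mem_perforated_of_lt (ht z hz hy)] at hyG
    exact hyG s hs (hzs hy)
  · rw [h.mem_perforated_of_le hxr] at hx
    push Not at hx
    by_cases hcl : ∃ s ∈ S, x ∈ closedCube s ρ
    · obtain ⟨s, hs, hxs⟩ := hcl
      have hsr : ¬ ‖s i‖ < r := fun hsr =>
        absurd (h.closedCube_subset_strip hs hsr hxs) (not_lt.2 hxr)
      have hj := hx s hs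
      rw [mem_cube] at hj
      push Not at hj
      obtain ⟨j, hj⟩ := hj
      -- near `x` only the cube about `s` is present, and it is left in the direction `j`
      have hV : (⋃ s' ∈ S.erase s, closedCube s' ρ)ᶜ ∈ 𝓝 x := by
        refine (isClosed_biUnion_finset fun s' _ =>
          isClosed_closedCube s' ρ).isOpen_compl.mem_nhds fun hx' => ?_
        obtain ⟨s', hs', hxs'⟩ := Set.mem_iUnion₂.1 hx'
        exact Finset.ne_of_mem_erase hs'
          (h.eq_of_mem_closedCube (Finset.mem_of_mem_erase hs') hs hxs' hxs)
      have hU : {y : Torus N | r < ‖y i‖} ∈ 𝓝 x :=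
        (isOpen_lt continuous_const (by fun_prop)).mem_nhds
          (h.lt_norm_of_mem_closedCube hs hsr hxs)
      filter_upwards [eventually_exists_cube_subset_le_dist hρ (by linarith) hj,
        eventually_cube_subset hV, eventually_cube_subset hU] with t ⟨z, hz, hzs⟩ ht1 ht2
      refine ⟨z, hz, fun y hy hyG => ?_⟩
      have hy2 : r < ‖y i‖ := ht2 z hz hy
      rw [h.mem_perforated_of_le hy2.le] at hyG
      obtain ⟨s', hs', hys'⟩ := hyG
      by_cases hss : s' = s
      · subst hss
        have h1 : ρ ≤ dist (y j) (s' j) := hzs hy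
        exact absurd (mem_cube.1 hys' j) (not_lt.2 h1)
      · exact ht1 z hz hy (Set.mem_iUnion₂.2 ⟨s', Finset.mem_erase.2 ⟨hss, hs'⟩,
          cube_subset_closedCube _ _ hys'⟩)
    · have hV : (⋃ s' ∈ S, closedCube s' ρ)ᶜ ∈ 𝓝 x := by
        refine (isClosed_biUnion_finset fun s' _ =>
          isClosed_closedCube s' ρ).isOpen_compl.mem_nhds fun hx' => hcl ?_
        obtain ⟨s', hs', hxs'⟩ := Set.mem_iUnion₂.1 hx'
        exact ⟨s', hs', hxs'⟩
      have hx0 : r ≤ dist (x i) 0 := by rwa [dist_zero_right]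
      filter_upwards [eventually_exists_cube_subset_le_dist h.strip_pos h.strip_lt hx0,
        eventually_cube_subset hV] with t ⟨z, hz, hzs⟩ ht1
      refine ⟨z, hz, fun y hy hyG => ?_⟩
      have hy2 : r ≤ dist (y i) 0 := hzs hy
      rw [dist_zero_right] at hy2
      rw [h.mem_perforated_of_le hy2] at hyG
      obtain ⟨s', hs', hys'⟩ := hyG
      exact ht1 z hz hy (Set.mem_iUnion₂.2 ⟨s', hs', cube_subset_closedCube _ _ hys'⟩)

theorem frontier_perforated_subset (h : IsPerforation i r S ρ) {y : Torus N}
    (hy : y ∈ frontier (perforated i r S ρ)) : ‖y i‖ = r ∨ ∃ s ∈ S, y ∈ closedCube s ρ := by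
  by_contra! hcon
  rw [(isOpen_perforated i r S ρ).frontier_eq] at hy
  rcases lt_or_gt_of_ne hcon.1 with hlt | hgt
  · exact hy.2 ((h.mem_perforated_of_lt hlt).2 hcon.2)
  · have hU : {y : Torus N | r < ‖y i‖} ∩ (⋃ s' ∈ S, closedCube s' ρ)ᶜ ∈ 𝓝 y := by
      refine inter_mem ((isOpen_lt continuous_const (by fun_prop)).mem_nhds hgt)
        ((isClosed_biUnion_finset fun s' _ =>
          isClosed_closedCube s' ρ).isOpen_compl.mem_nhds fun hx' => ?_)
      obtain ⟨s', hs', hxs'⟩ := Set.mem_iUnion₂.1 hx'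
      exact hcon.2 s' hs' hxs'
    obtain ⟨z, ⟨hz1, hz2⟩, hzG⟩ := mem_closure_iff_nhds.1 hy.1 _ hU
    have hz1 : r < ‖z i‖ := hz1
    rw [h.mem_perforated_of_le hz1.le] at hzG
    obtain ⟨s', hs', hzs'⟩ := hzG
    exact hz2 (Set.mem_iUnion₂.2 ⟨s', hs', cube_subset_closedCube _ _ hzs'⟩)

/-- Every cube contributes to the boundary: the center of its face in the direction `i` is a
boundary point. -/
theorem exists_mem_frontier_mem_closedCube (h : IsPerforation i r S ρ) {s : Torus N}
    (hs : s ∈ S) : ∃ y ∈ frontier (perforated i r S ρ), y ∈ closedCube s ρ := by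
  have hρ := h.pos
  have hρ' := h.lt
  have hdist : ∀ t : ℝ, 0 ≤ t → t ≤ 1 / 2 → dist ((s + axis i t) i) (s i) = t := by
    intro t ht0 ht
    rw [PiLp.add_apply, axis_apply_self, dist_eq_norm, add_sub_cancel_left,
      UnitAddCircle.norm_coe_eq_abs (by rwa [abs_of_nonneg ht0]), abs_of_nonneg ht0]
  have hmem : s + axis i ρ ∈ closedCube s ρ := by
    intro j
    by_cases hj : j = i
    · subst hj
      exact (hdist ρ hρ.le (by linarith)).le
    · rw [PiLp.add_apply, axis_apply_of_ne hj, add_zero, dist_self]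
      exact hρ.le
  have hcont : Continuous fun t : ℝ => s + axis i t := by
    have := continuous_axis i
    fun_prop
  refine ⟨s + axis i ρ, ?_, hmem⟩
  rw [(isOpen_perforated i r S ρ).frontier_eq]
  by_cases hsr : ‖s i‖ < r
  · have hin := h.closedCube_subset_strip hs hsr hmem
    refine ⟨?_, fun hG => (h.mem_perforated_of_lt hin).1 hG s hs hmem⟩
    have hV : strip i r ∩ (⋃ s' ∈ S.erase s, closedCube s' ρ)ᶜ ∈ 𝓝 (s + axis i ρ) := by
      refine inter_mem ((isOpen_strip i r).mem_nhds hin) ((isClosed_biUnion_finset fun s' _ =>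
        isClosed_closedCube s' ρ).isOpen_compl.mem_nhds fun hx' => ?_)
      obtain ⟨s', hs', hxs'⟩ := Set.mem_iUnion₂.1 hx'
      exact Finset.ne_of_mem_erase hs'
        (h.eq_of_mem_closedCube (Finset.mem_of_mem_erase hs') hs hxs' hmem)
    refine mem_closure_of_tendsto (b := 𝓝[>] ρ)
      ((hcont.tendsto ρ).mono_left nhdsWithin_le_nhds) ?_
    filter_upwards [((hcont.tendsto ρ).mono_left nhdsWithin_le_nhds).eventually_mem hV,
      Ioo_mem_nhdsGT (by linarith : ρ < 1 / 2)] with t ht ht2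
    refine (h.mem_perforated_of_lt ht.1).2 fun s' hs' hts' => ?_
    by_cases hss : s' = s
    · subst hss
      have := hts' i
      rw [hdist t (by linarith [ht2.1]) ht2.2.le] at this
      linarith [ht2.1]
    · exact ht.2 (Set.mem_iUnion₂.2 ⟨s', Finset.mem_erase.2 ⟨hss, hs'⟩, hts'⟩)
  · have hout := h.lt_norm_of_mem_closedCube hs hsr hmem
    refine ⟨?_, fun hG => ?_⟩
    · refine mem_closure_of_tendsto (b := 𝓝[<] ρ)
        ((hcont.tendsto ρ).mono_left nhdsWithin_le_nhds) ?_
      filter_upwards [Ioo_mem_nhdsLT hρ] with t ht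
      have hc : s + axis i t ∈ cube s ρ := by
        rw [mem_cube]
        intro j
        by_cases hj : j = i
        · subst hj
          rw [hdist t ht.1.le (by linarith [ht.2])]
          exact ht.2
        · rw [PiLp.add_apply, axis_apply_of_ne hj, add_zero, dist_self]
          exact hρ
      exact (h.mem_perforated_of_le (h.lt_norm_of_mem_closedCube hs hsr
        (cube_subset_closedCube _ _ hc)).le).2 ⟨s, hs, hc⟩
    · obtain ⟨s', hs', hxs'⟩ := (h.mem_perforated_of_le hout.le).1 hG
      have hss := h.eq_of_mem_closedCube hs hs' hmem (cube_subset_closedCube _ _ hxs')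
      subst hss
      have := mem_cube.1 hxs' i
      rw [hdist ρ hρ.le (by linarith)] at this
      linarith

/-- The points of `S` are close to the boundary of the perforated strip. -/
theorem infDist_frontier_le (h : IsPerforation i r S ρ) {s : Torus N} (hs : s ∈ S)
    (x : Torus N) :
    Metric.infDist x (frontier (perforated i r S ρ)) ≤ dist x s + N * ρ := by
  obtain ⟨y, hy, hys⟩ := h.exists_mem_frontier_mem_closedCube hs
  refine (Metric.infDist_le_dist_of_mem hy).trans ((dist_triangle x s y).trans ?_)
  rw [dist_comm s y]
  linarith [dist_le_of_forall_dist_le hys]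

/-- A point close to the boundary of the perforated strip is close to the boundary of the strip
or to a point of `S`. -/
theorem of_infDist_frontier_lt (h : IsPerforation i r S ρ) {ε : ℝ} {x : Torus N}
    (hne : S.Nonempty) (hx : Metric.infDist x (frontier (perforated i r S ρ)) < ε) :
    |‖x i‖ - r| < ε ∨ ∃ s ∈ S, ∃ y ∈ closedCube s ρ, dist x y < ε := by
  obtain ⟨s, hs⟩ := hne
  obtain ⟨y0, hy0, -⟩ := h.exists_mem_frontier_mem_closedCube hs
  obtain ⟨y, hy, hxy⟩ := (Metric.infDist_lt_iff ⟨y0, hy0⟩).1 hx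
  rcases h.frontier_perforated_subset hy with hyr | ⟨s, hs, hys⟩
  · left
    rw [← hyr]
    refine lt_of_le_of_lt ((abs_norm_sub_norm_le _ _).trans ?_) hxy
    rw [← dist_eq_norm]
    exact dist_apply_le x y i
  · exact Or.inr ⟨s, hs, y, hys, hxy⟩

end IsPerforation

theorem vol_real_strip (i : Fin N) {r : ℝ} (h0 : 0 ≤ r) (h1 : r ≤ 1 / 2) :
    (vol N).real (strip i r) = 2 * r := by
  rw [measureReal_def, vol_strip i h0 h1, ENNReal.toReal_ofReal (by linarith)]

theorem strip_subset_strip (i : Fin N) {r r' : ℝ} (h : r ≤ r') : strip i r ⊆ strip i r' :=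
  fun _ hx => lt_of_lt_of_le hx h

theorem vol_real_strip_diff (i : Fin N) {r r' : ℝ} (h0 : 0 ≤ r) (h : r ≤ r') (h1 : r' ≤ 1 / 2) :
    (vol N).real (strip i r' \ strip i r) = 2 * (r' - r) := by
  rw [measureReal_sdiff (strip_subset_strip i h) (isOpen_strip i r).measurableSet,
    vol_real_strip i (h0.trans h) h1, vol_real_strip i h0 (h.trans h1)]
  ring

theorem vol_real_strip_symmDiff (i : Fin N) {r r' : ℝ} (h0 : 0 ≤ r) (h0' : 0 ≤ r')
    (h1 : r ≤ 1 / 2) (h1' : r' ≤ 1 / 2) :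
    (vol N).real (strip i r ∆ strip i r') = 2 * |r - r'| := by
  have hm : ∀ r : ℝ, MeasurableSet (strip i r) := fun r => (isOpen_strip i r).measurableSet
  rcases le_total r r' with h | h
  · rw [real_symmDiff (hm r) (hm r'), Set.sdiff_eq_empty.2 (strip_subset_strip i h),
      vol_real_strip_diff i h0 h h1', abs_of_nonpos (by linarith)]
    simp
  · rw [real_symmDiff (hm r) (hm r'), Set.sdiff_eq_empty.2 (strip_subset_strip i h),
      vol_real_strip_diff i h0' h h1, abs_of_nonneg (by linarith)]
    simp

theorem vol_real_near_boundary_le (i : Fin N) {r κ : ℝ} (h0 : 0 ≤ κ) (h1 : κ ≤ r)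
    (h2 : r + κ ≤ 1 / 2) : (vol N).real {x : Torus N | |‖x i‖ - r| < κ} ≤ 4 * κ := by
  have hsub : {x : Torus N | |‖x i‖ - r| < κ} ⊆ strip i (r + κ) \ strip i (r - κ) := by
    intro x hx
    have hx : |‖x i‖ - r| < κ := hx
    rw [abs_lt] at hx
    refine ⟨?_, fun hx' => ?_⟩
    · change ‖x i‖ < r + κ
      linarith [hx.2]
    · have hx' : ‖x i‖ < r - κ := hx'
      linarith [hx.1]
  refine (measureReal_mono hsub).trans ?_
  rw [vol_real_strip_diff i (by linarith) (by linarith) h2]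
  linarith

/-- A strip can be perforated by arbitrarily small cubes about any finite set of points off its
boundary, its half-width being adjusted so that the volume is preserved. -/
theorem exists_isPerforation (hN : 2 ≤ N) (i : Fin N) {r₀ : ℝ} (hr0 : 0 < r₀) (hr1 : r₀ < 1 / 2)
    (S : Finset (Torus N)) (hS : ∀ s ∈ S, ‖s i‖ ≠ r₀) {κ : ℝ} (hκ : 0 < κ) :
    ∃ r ρ : ℝ, IsPerforation i r S ρ ∧ |r - r₀| ≤ κ ∧ ρ ≤ κ ∧ N * ρ ≤ κ ∧
      (vol N).real (perforated i r S ρ) = 2 * r₀ ∧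
      perimeter (perforated i r S ρ) ≤ ENNReal.ofReal (2 + κ) ∧
      (vol N).real (perforated i r S ρ ∆ strip i r₀) ≤ κ := by
  set a : ℝ := ((S.filter (fun s => ‖s i‖ < r₀)).card : ℝ) with ha
  set b : ℝ := ((S.filter (fun s => ¬ ‖s i‖ < r₀)).card : ℝ) with hb
  -- the width compensates for the volume of the cubes
  set r : ℝ → ℝ := fun ρ => r₀ + (a - b) * (2 * ρ) ^ N / 2 with hr
  have hpow : (0 : ℝ) ^ N = 0 := zero_pow (by omega)
  have hpow' : (0 : ℝ) ^ (N - 1) = 0 := zero_pow (by omega)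
  have hlim : ∀ g : ℝ → ℝ, Continuous g → Tendsto g (𝓝[>] 0) (𝓝 (g 0)) := fun g hg =>
    (hg.tendsto 0).mono_left nhdsWithin_le_nhds
  have hr_cont : Continuous r := by fun_prop
  have hr_zero : r 0 = r₀ := by simp [hr, hpow]
  have hrl := hlim r hr_cont
  rw [hr_zero] at hrl
  have e1 : ∀ᶠ ρ in 𝓝[>] (0 : ℝ), 0 < ρ := self_mem_nhdsWithin
  have e2 : ∀ᶠ ρ in 𝓝[>] (0 : ℝ), ρ < min (1 / 4) κ := by
    filter_upwards [Ioo_mem_nhdsGT (show (0 : ℝ) < min (1 / 4) κ by positivity)] with ρ h using h.2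
  have e3 := hrl.eventually (lt_mem_nhds hr0)
  have e4 := hrl.eventually (gt_mem_nhds hr1)
  have e5 : ∀ᶠ ρ in 𝓝[>] (0 : ℝ), ∀ s ∈ S, ρ < |‖s i‖ - r ρ| := by
    rw [Filter.eventually_all_finset]
    intro s hs
    have h1 := hlim (fun ρ => |‖s i‖ - r ρ| - ρ) (by fun_prop)
    have h2 : 0 < |‖s i‖ - r 0| - 0 := by
      rw [hr_zero, sub_zero]
      exact abs_pos.2 (sub_ne_zero.2 (hS s hs))
    filter_upwards [h1.eventually (lt_mem_nhds h2)] with ρ hρ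
    linarith
  have e6 : ∀ᶠ ρ in 𝓝[>] (0 : ℝ), ∀ s ∈ S, ∀ s' ∈ S, s ≠ s' →
      Disjoint (closedCube s ρ) (closedCube s' ρ) := by
    rw [Filter.eventually_all_finset]
    intro s _
    rw [Filter.eventually_all_finset]
    intro s' _
    by_cases hss : s = s'
    · exact Eventually.of_forall fun _ h => absurd hss h
    · obtain ⟨j, hj⟩ : ∃ j, s j ≠ s' j := by
        by_contra! h
        exact hss (PiLp.ext h)
      filter_upwards [Ioo_mem_nhdsGT (half_pos (dist_pos.2 hj))] with ρ hρ _
      rw [Set.disjoint_left]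
      intro x hx hx'
      have := dist_triangle_left (s j) (s' j) (x j)
      linarith [hx j, hx' j, hρ.2]
  have e7 : ∀ᶠ ρ in 𝓝[>] (0 : ℝ), ∀ s ∈ S, (‖s i‖ < r ρ ↔ ‖s i‖ < r₀) := by
    rw [Filter.eventually_all_finset]
    intro s hs
    rcases lt_or_gt_of_ne (hS s hs) with h | h
    · filter_upwards [hrl.eventually (lt_mem_nhds h)] with ρ hρ
      exact iff_of_true hρ h
    · filter_upwards [hrl.eventually (gt_mem_nhds h)] with ρ hρ
      exact iff_of_false (not_lt.2 hρ.le) (not_lt.2 h.le)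
  have e8 : ∀ᶠ ρ in 𝓝[>] (0 : ℝ), |r ρ - r₀| < κ := by
    have h1 := hlim (fun ρ => |r ρ - r₀|) (by fun_prop)
    simp only [hr_zero, sub_self, abs_zero] at h1
    exact h1.eventually (gt_mem_nhds hκ)
  have e9 : ∀ᶠ ρ in 𝓝[>] (0 : ℝ), N * ρ < κ := by
    have h1 := hlim (fun ρ => N * ρ) (by fun_prop)
    simp only [mul_zero] at h1
    exact h1.eventually (gt_mem_nhds hκ)
  have e10 : ∀ᶠ ρ in 𝓝[>] (0 : ℝ), S.card * (N * (2 * (2 * ρ) ^ (N - 1))) < κ := by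
    have h1 := hlim (fun ρ => S.card * (N * (2 * (2 * ρ) ^ (N - 1)))) (by fun_prop)
    simp only [hpow', mul_zero] at h1
    exact h1.eventually (gt_mem_nhds hκ)
  have e11 : ∀ᶠ ρ in 𝓝[>] (0 : ℝ), S.card * (2 * ρ) ^ N + 2 * |r ρ - r₀| < κ := by
    have h1 := hlim (fun ρ => S.card * (2 * ρ) ^ N + 2 * |r ρ - r₀|) (by fun_prop)
    simp only [hpow, hr_zero, sub_self, abs_zero, mul_zero, add_zero] at h1
    exact h1.eventually (gt_mem_nhds hκ)
  obtain ⟨ρ, h1, h2, h3, h4, h5, h6, h7, h8, h9, h10, h11⟩ :=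
    (e1.and (e2.and (e3.and (e4.and (e5.and (e6.and (e7.and (e8.and (e9.and
      (e10.and e11)))))))))).exists
  have hP : IsPerforation i (r ρ) S ρ :=
    { pos := h1
      lt := h2.trans_le (min_le_left _ _)
      strip_pos := h3
      strip_lt := h4
      away := h5
      disjoint := fun s hs s' hs' hne => h6 s hs s' hs' hne }
  refine ⟨r ρ, ρ, hP, h8.le, (h2.trans_le (min_le_right _ _)).le, h9.le, ?_, ?_, ?_⟩
  · rw [hP.vol_real_perforated, Finset.filter_congr h7,
      Finset.filter_congr fun s hs => not_congr (h7 s hs), ← ha, ← hb, hr]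
    ring
  · refine hP.perimeter_perforated_le.trans (ENNReal.ofReal_le_ofReal ?_)
    linarith
  · refine (measureReal_symmDiff_le (t := strip i (r ρ)) _ (measure_ne_top _ _)
      (measure_ne_top _ _)).trans (le_trans (add_le_add ?_ ?_) h11.le)
    · exact (measureReal_mono IsPerforation.symmDiff_subset (measure_ne_top _ _)).trans
        hP.vol_biUnion_closedCube_le
    · rw [vol_real_strip_symmDiff i h3.le hr0.le h4.le hr1.le]

/-! ### Grids -/

/-- The points of the torus whose coordinates are multiples of `1 / M`. -/
noncomputable def grid (N M : ℕ) : Finset (Torus N) :=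
  open Classical in
  Finset.univ.image fun k : Fin N → Fin M =>
    proj (WithLp.toLp 2 fun j => ((k j : ℕ) : ℝ) / M)

theorem card_grid_le (N M : ℕ) : (grid N M).card ≤ M ^ N := by
  refine Finset.card_image_le.trans ?_
  simp

theorem exists_mem_grid {M : ℕ} (hM : 0 < M) (x : Torus N) :
    ∃ s ∈ grid N M, ∀ j, dist (x j) (s j) ≤ 1 / M := by
  have hM' : (0 : ℝ) < M := by exact_mod_cast hM
  have h : ∀ j, ∃ k : Fin M, dist (x j) ((((k : ℕ) : ℝ) / M : ℝ) : UnitAddCircle) ≤ 1 / M := by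
    intro j
    obtain ⟨b, hb, hbx⟩ := AddCircle.eq_coe_Ico (x j)
    have hb0 : 0 ≤ b * M := mul_nonneg hb.1 hM'.le
    refine ⟨⟨⌊b * M⌋₊, ?_⟩, ?_⟩
    · rw [Nat.floor_lt hb0]
      nlinarith [hb.2]
    · rw [← hbx, dist_eq_norm, ← AddCircle.coe_sub]
      refine (UnitAddCircle.norm_coe_le _).trans ?_
      have h1 := Nat.floor_le hb0
      have h2 := Nat.lt_floor_add_one (b * M)
      have h3 : b - (⌊b * M⌋₊ : ℝ) / M = (b * M - ⌊b * M⌋₊) / M := by field_simp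
      simp only
      rw [h3, abs_div, abs_of_pos hM']
      gcongr
      rw [abs_le]
      constructor <;> linarith
  choose k hk using h
  exact ⟨_, Finset.mem_image_of_mem _ (Finset.mem_univ k), hk⟩

/-- For odd `M`, no multiple of `1 / M` lies at distance `1 / 32` from the integers. -/
theorem norm_ne_of_mem_grid {M : ℕ} (hM : Odd M) {s : Torus N} (hs : s ∈ grid N M) (i : Fin N) :
    ‖s i‖ ≠ 1 / 32 := by
  obtain ⟨k, -, rfl⟩ := Finset.mem_image.1 hs
  have hM0 : (M : ℝ) ≠ 0 := by
    have := hM.pos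
    positivity
  obtain ⟨m, hm⟩ := hM
  intro h
  simp only [proj_apply] at h
  rw [UnitAddCircle.norm_eq] at h
  set n : ℤ := round (((k i : ℕ) : ℝ) / M)
  rcases (abs_eq (by norm_num)).1 h with h | h
  · have h2 : (32 : ℝ) * ((k i : ℕ) - n * M) = M := by
      field_simp at h
      linarith
    have h3 : (32 : ℤ) * ((k i : ℕ) - n * M) = M := by exact_mod_cast h2
    omega
  · have h2 : (32 : ℝ) * ((k i : ℕ) - n * M) = -M := by
      field_simp at h
      linarith
    have h3 : (32 : ℤ) * ((k i : ℕ) - n * M) = -M := by exact_mod_cast h2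
    omega

/-! ### Perforated strips with prescribed distance to the boundary -/

/-- Given a measurable set `D`, the strip of volume `1 / 16` can be perforated, with arbitrarily
small changes of volume and perimeter, in such a way that the distance to the boundary of the
perforated strip is at least `ε` on most of the complement of `D`, but much smaller than `ε` in
the mean on `D`. The perforation takes place about a grid of mesh much larger than `ε`, which
makes the distance to the boundary comparable to the mesh everywhere, and about a very fine net
of a large compact part of `D`. -/
theorem exists_perforated_strip (hN : 2 ≤ N) (i : Fin N) {D : Set (Torus N)}
    (hD : MeasurableSet D) {η : ℝ} (hη : 0 < η) :
    ∃ (G : Set (Torus N)) (ε : ℝ), MeasurableSet G ∧ lebesgueRep G = G ∧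
      vol N G = ENNReal.ofReal (1 / 16) ∧ perimeter G ≤ ENNReal.ofReal (2 + η) ∧
      (vol N).real (G ∆ strip i (1 / 32)) ≤ η ∧ 0 < ε ∧ ε ≤ 1 ∧
      ∫⁻ x in D ∪ G ∆ strip i (1 / 32), ENNReal.ofReal (Metric.infDist x (frontier G)) ∂(vol N) ≤
        ENNReal.ofReal (η * ε) ∧
      (vol N).real {x | x ∉ D ∧ Metric.infDist x (frontier G) < ε} ≤ η := by
  have hN0 : (0 : ℝ) < N := by
    have : 0 < N := by omega
    exact_mod_cast this
  have hN1 : (1 : ℝ) ≤ N := by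
    have : 1 ≤ N := by omega
    exact_mod_cast this
  obtain ⟨δ, hδ0, hδη, hδ1⟩ : ∃ δ : ℝ, 0 < δ ∧ 16 * δ ≤ η ∧ 64 * δ ≤ 1 := by
    refine ⟨min (η / 16) (1 / 64), by positivity, ?_, ?_⟩
    · linarith [min_le_left (η / 16) (1 / 64 : ℝ)]
    · linarith [min_le_right (η / 16) (1 / 64 : ℝ)]
  -- the distance to the boundary will be at most `2 * N / M`, and `2 * N / M * (3 * q) = η * ε / 2`
  -- for the choice `ε = δ / M` made below
  set q : ℝ := η * δ / (12 * N) with hq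
  have hq0 : 0 < q := by positivity
  obtain ⟨α, hα0, hα1, hαq⟩ : ∃ α : ℝ, 0 < α ∧ α ≤ 1 / 32 ∧ 4 * α ≤ q := by
    refine ⟨min (q / 4) (1 / 32), by positivity, min_le_right _ _, ?_⟩
    linarith [min_le_left (q / 4) (1 / 32 : ℝ)]
  -- the net must stay away from the boundary of the strip
  set A : Set (Torus N) := {x | |‖x i‖ - 1 / 32| < α} with hA
  have hAm : MeasurableSet A :=
    (isOpen_lt (by fun_prop) continuous_const : IsOpen A).measurableSet
  have hAv : (vol N).real A ≤ q :=
    (vol_real_near_boundary_le i hα0.le hα1 (by linarith)).trans hαq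
  -- disjoint compact sets filling most of the complement of `D` and of `D`
  have hcomp : ∀ (T : Set (Torus N)) (e : ℝ), 0 < e → MeasurableSet T → ∃ C ⊆ T, IsClosed C ∧
      (vol N).real (T \ C) ≤ e := by
    intro T e he hT
    obtain ⟨C, hCS, hC, hm⟩ := hT.exists_isClosed_sdiff_lt (measure_ne_top (vol N) T)
      (ENNReal.ofReal_pos.2 he).ne'
    exact ⟨C, hCS, hC, ENNReal.toReal_le_of_le_ofReal he.le hm.le⟩
  obtain ⟨C, hCD, hCc, hCv⟩ := hcomp Dᶜ (η / 4) (by linarith) hD.compl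
  obtain ⟨C', hCD', hCc', hCv'⟩ := hcomp (D \ A) q hq0 (hD.diff hAm)
  obtain ⟨σ, hσ0, hσ⟩ := Metric.exists_pos_forall_lt_edist hCc.isCompact hCc'
    (Set.disjoint_left.2 fun x hx hx' => hCD hx (hCD' hx').1)
  -- the mesh of the coarse grid
  obtain ⟨M, hModd, hM0, hMσ⟩ : ∃ M : ℕ, Odd M ∧ 0 < M ∧ 2 * (δ / M) ≤ σ := by
    obtain ⟨k, hk⟩ := exists_nat_gt (2 * δ / σ)
    have hσ0' : (0 : ℝ) < σ := by exact_mod_cast hσ0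
    refine ⟨2 * k + 1, ⟨k, rfl⟩, Nat.succ_pos _, ?_⟩
    rw [div_lt_iff₀ hσ0'] at hk
    rw [← mul_div_assoc, div_le_iff₀ (by positivity)]
    push_cast
    have hk0 : (0 : ℝ) ≤ k := k.cast_nonneg
    nlinarith
  have hM0' : (0 : ℝ) < M := by exact_mod_cast hM0
  have hM1 : (1 : ℝ) ≤ M := by exact_mod_cast hM0
  set ε : ℝ := δ / M with hε
  have hε0 : 0 < ε := by positivity
  have hεδ : ε ≤ δ := div_le_self hδ0.le hM1
  have hεM : ε ≤ 1 / M := by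
    rw [hε]
    gcongr
    linarith
  -- the fine net
  obtain ⟨t, htC, htf, htc⟩ := finite_cover_balls_of_compact hCc'.isCompact
    (show 0 < η * ε / 4 by positivity)
  classical
  set S : Finset (Torus N) := grid N M ∪ htf.toFinset with hSdef
  have hS : ∀ s ∈ S, ‖s i‖ ≠ 1 / 32 := by
    intro s hs
    rcases Finset.mem_union.1 hs with hs | hs
    · exact norm_ne_of_mem_grid hModd hs i
    · intro h
      refine (hCD' (htC (htf.mem_toFinset.1 hs))).2 ?_
      change |‖s i‖ - 1 / 32| < α
      rw [h, sub_self, abs_zero]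
      exact hα0
  set κ : ℝ := min (min η q) (min (η * ε / 4) ε) with hκ
  have hκ0 : 0 < κ := by positivity
  have hκη : κ ≤ η := (min_le_left _ _).trans (min_le_left _ _)
  have hκq : κ ≤ q := (min_le_left _ _).trans (min_le_right _ _)
  have hκηε : κ ≤ η * ε / 4 := (min_le_right _ _).trans (min_le_left _ _)
  have hκε : κ ≤ ε := (min_le_right _ _).trans (min_le_right _ _)
  obtain ⟨r, ρ, hP, hr, hρ, hNρ, hvol, hper, hdiff⟩ :=
    exists_isPerforation hN i (r₀ := 1 / 32) (by norm_num) (by norm_num) S hS hκ0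
  set G := perforated i r S ρ with hG
  set f : Torus N → ℝ := fun x => Metric.infDist x (frontier G) with hf
  have hf_all : ∀ x, f x ≤ 2 * N / M := by
    intro x
    obtain ⟨s, hs, hxs⟩ := exists_mem_grid hM0 x
    refine (hP.infDist_frontier_le (Finset.mem_union_left _ hs) x).trans ?_
    have h1 : dist x s ≤ N * (1 / M) := dist_le_of_forall_dist_le hxs
    have h2 : N * ρ ≤ N * (1 / M) := hNρ.trans (hκε.trans (hεM.trans (by
      nlinarith [show (0 : ℝ) < 1 / M by positivity])))
    calc dist x s + N * ρ ≤ N * (1 / M) + N * (1 / M) := add_le_add h1 h2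
      _ = 2 * N / M := by ring
  have hf_C' : ∀ x ∈ C', f x ≤ η * ε / 2 := by
    intro x hx
    obtain ⟨s, hs, hxs⟩ := Set.mem_iUnion₂.1 (htc hx)
    refine (hP.infDist_frontier_le
      (Finset.mem_union_right _ (htf.mem_toFinset.2 hs)) x).trans ?_
    have h1 : dist x s < η * ε / 4 := hxs
    linarith
  refine ⟨G, ε, (isOpen_perforated i r S ρ).measurableSet, hP.lebesgueRep_perforated, ?_,
    hper.trans (ENNReal.ofReal_le_ofReal (by linarith)), hdiff.trans hκη, hε0, by linarith,
    ?_, ?_⟩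
  · rw [← ofReal_measureReal, hvol]
    norm_num
  · set B : Set (Torus N) := (D \ A) \ C' ∪ A ∪ G ∆ strip i (1 / 32) with hB
    have hBv : (vol N).real B ≤ 3 * q := by
      refine (measureReal_union_le _ _).trans ?_
      have := measureReal_union_le (μ := vol N) ((D \ A) \ C') A
      linarith
    have hsub : D ∪ G ∆ strip i (1 / 32) ⊆ C' ∪ B := by
      rintro x (hx | hx)
      · by_cases hxA : x ∈ A
        · exact Or.inr (Or.inl (Or.inr hxA))
        · by_cases hxC : x ∈ C'
          · exact Or.inl hxC
          · exact Or.inr (Or.inl (Or.inl ⟨⟨hx, hxA⟩, hxC⟩))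
      · exact Or.inr (Or.inr hx)
    calc ∫⁻ x in D ∪ G ∆ strip i (1 / 32), ENNReal.ofReal (f x) ∂(vol N)
        ≤ ∫⁻ x in C' ∪ B, ENNReal.ofReal (f x) ∂(vol N) := lintegral_mono_set hsub
      _ ≤ ∫⁻ x in C', ENNReal.ofReal (f x) ∂(vol N) + ∫⁻ x in B, ENNReal.ofReal (f x) ∂(vol N) :=
          lintegral_union_le _ _ _
      _ ≤ ∫⁻ _ in C', ENNReal.ofReal (η * ε / 2) ∂(vol N) +
          ∫⁻ _ in B, ENNReal.ofReal (2 * N / M) ∂(vol N) := by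
          refine add_le_add (setLIntegral_mono' hCc'.measurableSet fun x hx =>
            ENNReal.ofReal_le_ofReal (hf_C' x hx)) (lintegral_mono fun x =>
            ENNReal.ofReal_le_ofReal (hf_all x))
      _ ≤ ENNReal.ofReal (η * ε / 2) + ENNReal.ofReal (2 * N / M) * ENNReal.ofReal (3 * q) := by
          rw [setLIntegral_const, setLIntegral_const]
          refine add_le_add (mul_le_of_le_one_right' prob_le_one) ?_
          exact mul_le_mul_right (vol_le_ofReal hBv) _
      _ = ENNReal.ofReal (η * ε) := by
          rw [← ENNReal.ofReal_mul (by positivity), ← ENNReal.ofReal_add (by positivity)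
            (by positivity)]
          congr 1
          rw [hq, hε]
          field_simp
          ring
  · have hsub : {x | x ∉ D ∧ f x < ε} ⊆ (Dᶜ \ C) ∪ {x | |‖x i‖ - 1 / 32| < 2 * ε} ∪
        ⋃ s ∈ grid N M, closedCube s (2 * ε) := by
      rintro x ⟨hxD, hxf⟩
      obtain ⟨s0, hs0, -⟩ := exists_mem_grid hM0 x
      rcases hP.of_infDist_frontier_lt ⟨s0, Finset.mem_union_left _ hs0⟩ hxf with h | h
      · refine Or.inl (Or.inr ?_)
        change |‖x i‖ - 1 / 32| < 2 * ε
        have := abs_sub_le ‖x i‖ r (1 / 32)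
        linarith
      · obtain ⟨s, hs, y, hys, hxy⟩ := h
        rcases Finset.mem_union.1 hs with hs | hs
        · refine Or.inr (Set.mem_iUnion₂.2 ⟨s, hs, fun j => ?_⟩)
          have h1 := dist_triangle (x j) (y j) (s j)
          have h2 := dist_apply_le x y j
          have h3 := hys j
          linarith
        · refine Or.inl (Or.inl ⟨hxD, fun hxC => ?_⟩)
          have h1 := hσ x hxC s (htC (htf.mem_toFinset.1 hs))
          rw [edist_nndist, ENNReal.coe_lt_coe, ← NNReal.coe_lt_coe, coe_nndist] at h1
          have h2 := dist_triangle x y s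
          have h3 := dist_le_of_forall_dist_le hys
          linarith
    refine (measureReal_mono hsub).trans ((measureReal_union_le _ _).trans ?_)
    have h1 := measureReal_union_le (μ := vol N) (Dᶜ \ C) {x | |‖x i‖ - 1 / 32| < 2 * ε}
    have h2 := vol_real_near_boundary_le (N := N) i (r := 1 / 32) (κ := 2 * ε) (by linarith)
      (by linarith) (by linarith)
    have h3 : (vol N).real (⋃ s ∈ grid N M, closedCube s (2 * ε)) ≤ 4 * δ := by
      refine (measureReal_biUnion_finset_le _ _).trans ?_
      refine (Finset.sum_le_sum (g := fun _ => (2 * (2 * ε)) ^ N) fun s _ =>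
        ENNReal.toReal_le_of_le_ofReal (by positivity)
          (vol_closedCube_le s (by linarith))).trans ?_
      rw [Finset.sum_const, nsmul_eq_mul]
      have hcard : ((grid N M).card : ℝ) ≤ (M : ℝ) ^ N := by exact_mod_cast card_grid_le N M
      calc ((grid N M).card : ℝ) * (2 * (2 * ε)) ^ N ≤ (M : ℝ) ^ N * (2 * (2 * ε)) ^ N := by
            gcongr
        _ = (4 * δ) ^ N := by
            rw [← mul_pow, hε]
            congr 1
            field_simp
            ring
        _ ≤ 4 * δ := pow_le_of_le_one (by linarith) (by linarith) (by omega)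
    linarith

/-! ### The lamella and a competitor of smaller perimeter -/

theorem isLamella_strip (i : Fin N) : IsLamella (strip i (1 / 32)) := by
  have hsum : ∀ x : EuclideanSpace ℝ (Fin N),
      ∑ j, ((Pi.single i (1 : ℤ) : Fin N → ℤ) j : ℝ) * x j = x i := by
    intro x
    rw [Finset.sum_eq_single i]
    · simp
    · intro j _ hj
      simp [hj]
    · simp
  refine ⟨Pi.single i 1, -(1 / 32), 1 / 32, ?_, by norm_num, by norm_num, ?_⟩
  · have h1 : Finset.univ.gcd (Pi.single i (1 : ℤ) : Fin N → ℤ) ∣ 1 := by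
      have := Finset.gcd_dvd (f := (Pi.single i (1 : ℤ) : Fin N → ℤ)) (Finset.mem_univ i)
      rwa [Pi.single_eq_same] at this
    rw [← Finset.normalize_gcd]
    exact normalize_eq_one.2 (isUnit_of_dvd_one h1)
  · simp only [hsum]
    ext x
    constructor
    · intro hx
      have hx : ‖x i‖ < 1 / 32 := hx
      choose t ht hn using fun j => (x j).exists_coe_eq_abs_eq_norm
      refine ⟨WithLp.toLp 2 t, ?_, PiLp.ext fun j => ht j⟩
      rw [← hn i] at hx
      exact abs_lt.1 hx
    · rintro ⟨y, hy, rfl⟩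
      exact (UnitAddCircle.norm_coe_le _).trans_lt (abs_lt.2 hy)

theorem measurePreserving_apply (i : Fin N) :
    MeasurePreserving (fun x : Torus N => x i) (vol N) volume := by
  have h1 : MeasurePreserving (measurableEquivPi N) (vol N) volume := by
    refine ⟨(measurableEquivPi N).measurable, ?_⟩
    rw [vol_eq_map, Measure.map_map (by fun_prop) (by fun_prop)]
    simp
  have : IsProbabilityMeasure (volume : Measure UnitAddCircle) := ⟨UnitAddCircle.measure_univ⟩
  exact (measurePreserving_eval (fun _ : Fin N => (volume : Measure UnitAddCircle)) i).comp h1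

/-- The field `sin (16 π xᵢ) eᵢ`, which is the outer normal on the boundary of the strip, bounds
its perimeter from below. -/
theorem two_le_perimeter_strip (i : Fin N) :
    ENNReal.ofReal 2 ≤ perimeter (strip i (1 / 32)) := by
  set g : Torus N → ℝ := fun x => (AddCircle.toCircle ((8 : ℤ) • x i) : ℂ).im with hg
  have hgC1 : IsC1 g := isC1_im_toCircle 8 i
  have hgb : ∀ x, |g x| ≤ 1 := fun x =>
    (Complex.abs_im_le_norm _).trans (le_of_eq (Circle.norm_coe _))
  have hgproj : ∀ y : EuclideanSpace ℝ (Fin N), g (proj y) = Real.sin (16 * Real.pi * y i) := by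
    intro y
    rw [hg]
    simp only [proj_apply]
    rw [← AddCircle.coe_zsmul, AddCircle.toCircle_apply_mk, Circle.coe_exp,
      Complex.exp_ofReal_mul_I_im, div_one, zsmul_eq_mul]
    congr 1
    push_cast
    ring
  set c : UnitAddCircle → ℝ := fun θ =>
    16 * Real.pi * (AddCircle.toCircle ((8 : ℤ) • θ) : ℂ).re with hc
  have hccoe : ∀ t : ℝ, c t = Real.cos (16 * Real.pi * t) * (16 * Real.pi) := by
    intro t
    rw [hc]
    simp only
    rw [← AddCircle.coe_zsmul, AddCircle.toCircle_apply_mk, Circle.coe_exp,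
      Complex.exp_ofReal_mul_I_re, div_one, zsmul_eq_mul, mul_comm]
    congr 2
    push_cast
    ring
  have hderiv : ∀ t : ℝ, HasDerivAt (fun s : ℝ => Real.sin (16 * Real.pi * s)) (c t) t := by
    intro t
    rw [hccoe]
    simpa using ((hasDerivAt_id t).const_mul (16 * Real.pi)).sin
  have hpd : ∀ x, pderiv i g x = c (x i) := by
    intro x
    obtain ⟨y, rfl⟩ := isOpenQuotientMap_proj.surjective x
    have h1 : (fun s : ℝ => g (proj y + axis i s)) =
        fun s => Real.sin (16 * Real.pi * (s + y i)) := by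
      ext s
      rw [axis, ← proj_add, hgproj]
      simp [add_comm]
    have h2 := (hderiv (0 + y i)).comp_add_const 0 (y i)
    rw [pderiv, h1, h2.deriv, zero_add, proj_apply]
  have hint : ∫ x in strip i (1 / 32), pderiv i g x ∂(vol N) = 2 := by
    have hcm : AEStronglyMeasurable ((Metric.ball (0 : UnitAddCircle) (1 / 32)).indicator c)
        volume := by
      refine AEStronglyMeasurable.indicator ?_ Metric.isOpen_ball.measurableSet
      have : Continuous c := by
        have := (AddCircle.continuous_toCircle (T := (1 : ℝ)))
        fun_prop
      exact this.aestronglyMeasurable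
    calc ∫ x in strip i (1 / 32), pderiv i g x ∂(vol N)
        = ∫ x, (Metric.ball (0 : UnitAddCircle) (1 / 32)).indicator c (x i) ∂(vol N) := by
          rw [← integral_indicator (isOpen_strip i _).measurableSet]
          refine integral_congr_ae (Eventually.of_forall fun x => ?_)
          have hiff : x ∈ strip i (1 / 32) ↔ x i ∈ Metric.ball (0 : UnitAddCircle) (1 / 32) := by
            rw [Metric.mem_ball, dist_zero_right]
            rfl
          by_cases hx : x ∈ strip i (1 / 32)
          · simp only [Set.indicator_of_mem hx, Set.indicator_of_mem (hiff.1 hx), hpd]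
          · simp only [Set.indicator_of_notMem hx, Set.indicator_of_notMem (mt hiff.2 hx)]
      _ = ∫ θ, (Metric.ball (0 : UnitAddCircle) (1 / 32)).indicator c θ := by
          rw [← (measurePreserving_apply (N := N) i).map_eq] at hcm ⊢
          exact (integral_map (by fun_prop) hcm).symm
      _ = ∫ t in Set.Ioc (-(1 / 2) : ℝ) (-(1 / 2) + 1),
            (Metric.ball (0 : UnitAddCircle) (1 / 32)).indicator c (t : UnitAddCircle) :=
          (UnitAddCircle.integral_preimage _ _).symm
      _ = ∫ t in Set.Ioc (-(1 / 2) : ℝ) (-(1 / 2) + 1),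
            (Set.Ioo (-(1 / 32) : ℝ) (1 / 32)).indicator (fun t => c t) t := by
          refine setIntegral_congr_fun measurableSet_Ioc fun t ht => ?_
          have hn : ‖(t : UnitAddCircle)‖ = |t| := UnitAddCircle.norm_coe_eq_abs (by
            rw [abs_le]
            constructor <;> linarith [ht.1, ht.2])
          have hiff : (t : UnitAddCircle) ∈ Metric.ball (0 : UnitAddCircle) (1 / 32) ↔
              t ∈ Set.Ioo (-(1 / 32) : ℝ) (1 / 32) := by
            rw [Metric.mem_ball, dist_zero_right, hn, abs_lt, Set.mem_Ioo]
          by_cases hx : t ∈ Set.Ioo (-(1 / 32) : ℝ) (1 / 32)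
          · simp only [Set.indicator_of_mem hx, Set.indicator_of_mem (hiff.2 hx)]
          · simp only [Set.indicator_of_notMem hx, Set.indicator_of_notMem (mt hiff.1 hx)]
      _ = ∫ t in (-(1 / 32) : ℝ)..(1 / 32), c t := by
          rw [setIntegral_indicator measurableSet_Ioo, Set.inter_eq_self_of_subset_right,
            intervalIntegral.integral_of_le (by norm_num), integral_Ioc_eq_integral_Ioo]
          intro t ht
          constructor <;> linarith [ht.1, ht.2]
      _ = 2 := by
          rw [intervalIntegral.integral_eq_sub_of_hasDerivAt (fun t _ => hderiv t)]
          · have e1 : 16 * Real.pi * (1 / 32) = Real.pi / 2 := by ring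
            have e2 : 16 * Real.pi * -(1 / 32) = -(Real.pi / 2) := by ring
            rw [e1, e2, Real.sin_neg, Real.sin_pi_div_two]
            norm_num
          · simp_rw [hccoe]
            exact Continuous.intervalIntegrable (by fun_prop) _ _
  have := (hgC1.isTestField hgb i).le_perimeter (strip i (1 / 32))
  simp only [divergence_single] at this
  rwa [hint] at this

/-- A product of two short arcs has the volume of the strip and a smaller perimeter. -/
theorem exists_perimeter_le_one (hN : 2 ≤ N) : ∃ Q : Set (Torus N), MeasurableSet Q ∧
    vol N Q = ENNReal.ofReal (1 / 16) ∧ perimeter Q ≤ 1 := by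
  have hij : (⟨0, by omega⟩ : Fin N) ≠ ⟨1, by omega⟩ := by simp
  refine ⟨box {⟨0, by omega⟩, ⟨1, by omega⟩} 0 fun _ => 1 / 8,
    (isOpen_box _ _ _).measurableSet, ?_, ?_⟩
  · rw [vol_box _ _ (fun _ _ => by norm_num) (fun _ _ => by norm_num), Finset.prod_const,
      Finset.card_pair hij]
    norm_num
  · refine (perimeter_box_le _ _ (fun _ _ => by norm_num) (fun _ _ => by norm_num)).trans ?_
    rw [Finset.sum_congr rfl (g := fun _ => (1 / 2 : ℝ)), Finset.sum_const, Finset.card_pair hij]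
    · norm_num
    · intro k hk
      rw [Finset.prod_const, Finset.card_erase_of_mem hk, Finset.card_pair hij]
      norm_num

/-! ### Existence of minimizers -/

theorem continuous_setLIntegral_symmDiff {f : Torus N → ℝ} (hf : Continuous f)
    (G : Set (Torus N)) : Continuous fun F : MeasuredSets (vol N) =>
      ∫⁻ x in (F : Set (Torus N)) ∆ G, ENNReal.ofReal (f x) ∂(vol N) := by
  obtain ⟨C, hC⟩ := isCompact_univ.exists_bound_of_continuousOn hf.continuousOn
  refine continuous_of_le_add_edist (ENNReal.ofReal C) ENNReal.ofReal_ne_top fun A B => ?_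
  have hsub : (A : Set (Torus N)) ∆ G ⊆ ((B : Set (Torus N)) ∆ G) ∪ ((A : Set (Torus N)) ∆ B) := by
    intro x
    simp only [Set.mem_union, Set.mem_symmDiff]
    tauto
  refine (lintegral_mono_set hsub).trans ((lintegral_union_le _ _ _).trans
    (add_le_add le_rfl ?_))
  refine (lintegral_mono fun x => ENNReal.ofReal_le_ofReal
    ((le_abs_self _).trans (hC x trivial))).trans (le_of_eq ?_)
  rw [setLIntegral_const]
  rfl

/-- The direct method: the perimeter plus a continuous functional has a minimizer under a volume
constraint. -/
theorem exists_minimizer_perimeter_add {Φ : MeasuredSets (vol N) → ℝ≥0∞} (hΦ : Continuous Φ)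
    {m : ℝ≥0∞} {Q : MeasuredSets (vol N)} (hQ : vol N Q = m)
    (hQfin : perimeter (Q : Set (Torus N)) + Φ Q ≠ ⊤) :
    ∃ F : MeasuredSets (vol N), vol N F = m ∧
      ∀ F' : MeasuredSets (vol N), vol N F' = m →
        perimeter (F : Set (Torus N)) + Φ F ≤ perimeter (F' : Set (Torus N)) + Φ F' := by
  obtain ⟨c, hc⟩ : ∃ c : ℝ≥0, (c : ℝ≥0∞) = perimeter (Q : Set (Torus N)) + Φ Q :=
    ⟨_, ENNReal.coe_toNNReal hQfin⟩
  have hK : IsCompact ({F : MeasuredSets (vol N) | perimeter (F : Set (Torus N)) ≤ c} ∩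
      {F | vol N F = m}) :=
    (isCompact_perimeter_le c).inter_right
      (isClosed_eq MeasuredSets.continuous_measure continuous_const)
  have hQK : Q ∈ {F : MeasuredSets (vol N) | perimeter (F : Set (Torus N)) ≤ c} ∩
      {F | vol N F = m} :=
    ⟨show perimeter (Q : Set (Torus N)) ≤ c by rw [hc]; exact le_self_add, hQ⟩
  obtain ⟨F, hF, hmin⟩ := LowerSemicontinuousOn.exists_isMinOn
    (f := fun F : MeasuredSets (vol N) => perimeter (F : Set (Torus N)) + Φ F) ⟨Q, hQK⟩ hK
    ((lowerSemicontinuous_perimeter.add hΦ.lowerSemicontinuous).lowerSemicontinuousOn _)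
  refine ⟨F, hF.2, fun F' hF' => ?_⟩
  rcases le_total (perimeter (F' : Set (Torus N)) + Φ F') c with h | h
  · exact hmin ⟨le_self_add.trans h, hF'⟩
  · refine le_trans ?_ h
    rw [hc]
    exact hmin hQK

theorem exists_isVolumeConstrainedMinimizer (h : ℝ) {G Q : Set (Torus N)}
    (hQ : MeasurableSet Q) (hQv : vol N Q = vol N G) (hQp : perimeter Q ≠ ⊤) :
    ∃ F, IsVolumeConstrainedMinimizer h G F := by
  have hf : Continuous fun x : Torus N => Metric.infDist x (frontier G) :=
    Metric.continuous_infDist_pt _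
  have hΦ : Continuous fun F : MeasuredSets (vol N) => ENNReal.ofReal (1 / h) *
      ∫⁻ x in (F : Set (Torus N)) ∆ G, ENNReal.ofReal (Metric.infDist x (frontier G)) ∂(vol N) :=
    (ENNReal.continuous_const_mul ENNReal.ofReal_ne_top).comp
      (continuous_setLIntegral_symmDiff hf G)
  obtain ⟨Q', hQ'⟩ : ∃ Q' : MeasuredSets (vol N), (Q' : Set (Torus N)) = Q := ⟨⟨Q, hQ⟩, rfl⟩
  obtain ⟨F, hF, hmin⟩ := exists_minimizer_perimeter_add hΦ (m := vol N G) (Q := Q')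
    (by rw [hQ', hQv]) (by
      rw [hQ']
      refine ENNReal.add_ne_top.2 ⟨hQp, ENNReal.mul_ne_top ENNReal.ofReal_ne_top ?_⟩
      refine ne_top_of_le_ne_top ?_ (setLIntegral_le_lintegral _ _)
      have := hf.integrable_torus Set.univ
      rw [Measure.restrict_univ] at this
      exact this.lintegral_lt_top.ne)
  exact ⟨F, F.2, hF, fun F' hF' hv => hmin ⟨F', hF'⟩ hv⟩

/-- Among the sets of least perimeter for their volume, some set is closest to a given set `E`. -/
theorem exists_isoperimetric_closest {m : ℝ≥0∞} {Q : Set (Torus N)} (hQ : MeasurableSet Q)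
    (hQv : vol N Q = m) (hQp : perimeter Q ≠ ⊤) (E : Set (Torus N)) :
    ∃ F : Set (Torus N), MeasurableSet F ∧ vol N F = m ∧
      (∀ F', MeasurableSet F' → vol N F' = m → perimeter F ≤ perimeter F') ∧
      ∀ F', MeasurableSet F' → vol N F' = m → perimeter F' ≤ perimeter F →
        vol N (F ∆ E) ≤ vol N (F' ∆ E) := by
  obtain ⟨F₁, hF₁, hmin⟩ := exists_minimizer_perimeter_add (Φ := fun _ => 0) continuous_const
    (m := m) (Q := (⟨Q, hQ⟩ : MeasuredSets (vol N))) hQv (by rw [add_zero]; exact hQp)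
  simp only [add_zero] at hmin
  have hfin : perimeter (F₁ : Set (Torus N)) ≠ ⊤ := ne_top_of_le_ne_top hQp (hmin ⟨Q, hQ⟩ hQv)
  obtain ⟨c, hc⟩ : ∃ c : ℝ≥0, (c : ℝ≥0∞) = perimeter (F₁ : Set (Torus N)) :=
    ⟨_, ENNReal.coe_toNNReal hfin⟩
  have hK : IsCompact ({F : MeasuredSets (vol N) | perimeter (F : Set (Torus N)) ≤ c} ∩
      {F | vol N F = m}) :=
    (isCompact_perimeter_le c).inter_right
      (isClosed_eq MeasuredSets.continuous_measure continuous_const)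
  have hcont : Continuous fun F : MeasuredSets (vol N) => vol N ((F : Set (Torus N)) ∆ E) := by
    have := continuous_setLIntegral_symmDiff (N := N) (f := fun _ => 1) continuous_const E
    simpa using this
  obtain ⟨F, hF, hFmin⟩ := hK.exists_isMinOn ⟨F₁, hc.ge, hF₁⟩ hcont.continuousOn
  have hF1 : perimeter (F : Set (Torus N)) ≤ perimeter (F₁ : Set (Torus N)) := by
    rw [← hc]
    exact hF.1
  refine ⟨F, F.2, hF.2, fun F' hF' hv => hF1.trans (hmin ⟨F', hF'⟩ hv), fun F' hF' hv hp => ?_⟩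
  exact hFmin (show (⟨F', hF'⟩ : MeasuredSets (vol N)) ∈ _ from ⟨(hp.trans hF1).trans hc.ge, hv⟩)

/-! ### Selection of a limit of minimizers -/

/-- Comparison with an isoperimetric set `F₀` shows that a minimizer `F` of the functional of
`G` has almost least perimeter, and that `F ∆ E` lies almost entirely in `F₀ ∆ E`, when the
distance to the boundary of `G` is mostly at least `ε` off `F₀ ∆ E` but much smaller than `ε` in the
mean on `F₀ ∆ E`. -/
theorem IsVolumeConstrainedMinimizer.estimates {h : ℝ} (hh : 0 < h) {G E F F₀ : Set (Torus N)}
    (hF : IsVolumeConstrainedMinimizer h G F) (hGm : MeasurableSet G)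
    (hF₀m : MeasurableSet F₀) (hF₀v : vol N F₀ = vol N G) (hF₀p : perimeter F₀ ≠ ⊤)
    (hF₀min : perimeter F₀ ≤ perimeter F) {η ε : ℝ} (hη : 0 ≤ η) (hε : 0 < ε) (hε1 : ε ≤ 1)
    (hGE : (vol N).real (G ∆ E) ≤ η)
    (hsmall : ∫⁻ x in F₀ ∆ E ∪ G ∆ E, ENNReal.ofReal (Metric.infDist x (frontier G)) ∂(vol N) ≤
      ENNReal.ofReal (η * ε))
    (hlarge : (vol N).real {x | x ∉ F₀ ∆ E ∧ Metric.infDist x (frontier G) < ε} ≤ η) :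
    perimeter F ≤ perimeter F₀ + ENNReal.ofReal (1 / h) * ENNReal.ofReal η ∧
      vol N ((F ∆ E) \ (F₀ ∆ E)) ≤ ENNReal.ofReal (3 * η) := by
  set f : Torus N → ℝ≥0∞ := fun x => ENNReal.ofReal (Metric.infDist x (frontier G)) with hf
  have hfm : Measurable f :=
    ((Metric.continuous_infDist_pt _).measurable).ennreal_ofReal
  set k := ENNReal.ofReal (1 / h) with hk
  have hk0 : k ≠ 0 := (ENNReal.ofReal_pos.2 (by positivity)).ne'
  have hkt : k ≠ ⊤ := ENNReal.ofReal_ne_top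
  have hI₀ : ∫⁻ x in F₀ ∆ G, f x ∂(vol N) ≤ ENNReal.ofReal (η * ε) := by
    refine (lintegral_mono_set ?_).trans hsmall
    intro x
    simp only [Set.mem_union, Set.mem_symmDiff]
    tauto
  have hJ : perimeter F + k * ∫⁻ x in F ∆ G, f x ∂(vol N) ≤
      perimeter F₀ + k * ENNReal.ofReal (η * ε) :=
    (hF.2.2 F₀ hF₀m hF₀v).trans (add_le_add le_rfl (mul_le_mul_right hI₀ k))
  have hI : ∫⁻ x in F ∆ G, f x ∂(vol N) ≤ ENNReal.ofReal (η * ε) := by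
    have h1 : perimeter F₀ + k * ∫⁻ x in F ∆ G, f x ∂(vol N) ≤
        perimeter F₀ + k * ENNReal.ofReal (η * ε) := (add_le_add hF₀min le_rfl).trans hJ
    exact (ENNReal.mul_le_mul_iff_right hk0 hkt).1 ((ENNReal.add_le_add_iff_left hF₀p).1 h1)
  refine ⟨?_, ?_⟩
  · refine le_self_add.trans (hJ.trans (add_le_add le_rfl (mul_le_mul_right ?_ k)))
    exact ENNReal.ofReal_le_ofReal (mul_le_of_le_one_right hη hε1)
  · have hmarkov : vol N ({x | ENNReal.ofReal ε ≤ f x} ∩ (F ∆ G)) ≤ ENNReal.ofReal η := by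
      have h1 := mul_meas_ge_le_lintegral (μ := (vol N).restrict (F ∆ G)) hfm (ENNReal.ofReal ε)
      rw [Measure.restrict_apply' (hF.1.symmDiff hGm)] at h1
      have h2 := h1.trans hI
      rw [mul_comm η ε, ENNReal.ofReal_mul hε.le] at h2
      exact (ENNReal.mul_le_mul_iff_right (ENNReal.ofReal_pos.2 hε).ne' ENNReal.ofReal_ne_top).1 h2
    have hsub : (F ∆ E) \ (F₀ ∆ E) ⊆ ({x | ENNReal.ofReal ε ≤ f x} ∩ (F ∆ G)) ∪
        {x | x ∉ F₀ ∆ E ∧ Metric.infDist x (frontier G) < ε} ∪ (G ∆ E) := by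
      rintro x ⟨hx, hxD⟩
      by_cases hxG : x ∈ G ∆ E
      · exact Or.inr hxG
      · have hxF : x ∈ F ∆ G := by
          simp only [Set.mem_symmDiff] at hx hxG ⊢
          tauto
        rcases lt_or_ge (Metric.infDist x (frontier G)) ε with h | h
        · exact Or.inl (Or.inr ⟨hxD, h⟩)
        · exact Or.inl (Or.inl ⟨ENNReal.ofReal_le_ofReal h, hxF⟩)
    refine (measure_mono hsub).trans ((measure_union_le _ _).trans (le_trans
      (add_le_add ((measure_union_le _ _).trans (add_le_add hmarkov (vol_le_ofReal hlarge)))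
      (vol_le_ofReal hGE)) (le_of_eq ?_)))
    rw [← ENNReal.ofReal_add hη hη, ← ENNReal.ofReal_add (by positivity) hη]
    congr 1
    ring

/-- Let `F₀` be a set of least perimeter for its volume that is closest to `E` among such sets. If
the perimeters of the sets `Fₙ` of the same volume tend to the least one and `Fₙ ∆ E` lies
asymptotically in `F₀ ∆ E`, then `Fₙ` converges to `F₀`: every limit `F` has least perimeter and
satisfies `F ∆ E ⊆ F₀ ∆ E`, so it equals `F₀` by the choice of `F₀`. -/
theorem tendsto_of_isoperimetric_closest {m : ℝ≥0∞} {E F₀ : Set (Torus N)}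
    (hE : MeasurableSet E) (hF₀m : MeasurableSet F₀) (hF₀p : perimeter F₀ ≠ ⊤)
    (hclosest : ∀ F', MeasurableSet F' → vol N F' = m → perimeter F' ≤ perimeter F₀ →
        vol N (F₀ ∆ E) ≤ vol N (F' ∆ E))
    {u : ℕ → MeasuredSets (vol N)} (huv : ∀ n, vol N (u n) = m) {a b : ℕ → ℝ≥0∞}
    (ha : Tendsto a atTop (𝓝 0)) (hb : Tendsto b atTop (𝓝 0)) (hafin : ∀ n, a n ≤ a 0)
    (ha0 : a 0 ≠ ⊤)
    (hup : ∀ n, perimeter (u n : Set (Torus N)) ≤ perimeter F₀ + a n)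
    (hus : ∀ n, vol N (((u n : Set (Torus N)) ∆ E) \ (F₀ ∆ E)) ≤ b n) :
    Tendsto (fun n => vol N ((u n : Set (Torus N)) ∆ F₀)) atTop (𝓝 0) := by
  obtain ⟨L, hL⟩ : ∃ L : MeasuredSets (vol N), (L : Set (Torus N)) = F₀ := ⟨⟨F₀, hF₀m⟩, rfl⟩
  obtain ⟨c, hc⟩ : ∃ c : ℝ≥0, (c : ℝ≥0∞) = perimeter F₀ + a 0 :=
    ⟨_, ENNReal.coe_toNNReal (ENNReal.add_ne_top.2 ⟨hF₀p, ha0⟩)⟩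
  have huL : Tendsto u atTop (𝓝 L) := by
    rw [tendsto_iff_ultrafilter]
    intro g hg
    obtain ⟨F, -, hF⟩ := (isCompact_perimeter_le (N := N) c).ultrafilter_le_nhds (g.map u) (by
      rw [le_principal_iff]
      refine Ultrafilter.mem_map.2 (univ_mem' fun n => ?_)
      change perimeter (u n : Set (Torus N)) ≤ c
      rw [hc]
      exact (hup n).trans (add_le_add le_rfl (hafin n)))
    have hF : Tendsto u g (𝓝 F) := hF
    have hFm : MeasurableSet (F : Set (Torus N)) := F.2
    have hFv : vol N F = m := by
      have h1 := (MeasuredSets.continuous_measure.tendsto F).comp hF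
      exact tendsto_nhds_unique h1 (tendsto_const_nhds.congr fun n => (huv n).symm)
    have hFp : perimeter (F : Set (Torus N)) ≤ perimeter F₀ := by
      refine le_of_forall_lt fun c hc => ?_
      by_contra! hcon
      obtain ⟨d, hd1, hd2⟩ := exists_between hc
      have h1 := hF.eventually (lowerSemicontinuous_perimeter F d hd2)
      have h2 : Tendsto (fun n => perimeter F₀ + a n) g (𝓝 (perimeter F₀ + 0)) :=
        (tendsto_const_nhds.add ha).mono_left hg
      rw [add_zero] at h2
      have h3 : d ≤ perimeter F₀ :=
        ge_of_tendsto h2 (h1.mono fun n hn => hn.le.trans (hup n))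
      exact absurd (hd1.trans_le h3) (not_lt.2 hcon)
    have hFs : vol N (((F : Set (Torus N)) ∆ E) \ (F₀ ∆ E)) = 0 := by
      have hcont : Continuous fun A : MeasuredSets (vol N) =>
          vol N (((A : Set (Torus N)) ∆ E) \ (F₀ ∆ E)) := by
        refine continuous_of_le_add_edist 1 ENNReal.one_ne_top fun A B => ?_
        rw [one_mul]
        refine (measure_mono ?_).trans (measure_union_le _ ((A : Set (Torus N)) ∆ B))
        intro x
        simp only [Set.mem_union, Set.mem_sdiff, Set.mem_symmDiff]
        tauto
      have h1 := (hcont.tendsto F).comp hF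
      refine tendsto_nhds_unique h1 ?_
      exact tendsto_of_tendsto_of_tendsto_of_le_of_le tendsto_const_nhds (hb.mono_left hg)
        (fun _ => zero_le) hus
    have hae : ((F : Set (Torus N)) ∆ E : Set (Torus N)) =ᵐ[vol N] (F₀ ∆ E : Set (Torus N)) :=
      ae_eq_of_ae_subset_of_measure_ge (ae_le_set.2 hFs) (hclosest F hFm hFv hFp)
        (hFm.symmDiff hE).nullMeasurableSet (measure_ne_top _ _)
    have hzero : edist F L = 0 := by
      rw [MeasuredSets.edist_def, hL]
      have e : (F : Set (Torus N)) ∆ F₀ = ((F : Set (Torus N)) ∆ E) ∆ (F₀ ∆ E) := by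
        rw [symmDiff_symmDiff_symmDiff_comm, symmDiff_self, symmDiff_bot]
      rw [e]
      exact measure_symmDiff_eq_zero_iff.2 hae
    rw [← (EMetric.inseparable_iff.2 hzero).nhds_eq]
    exact hF
  have := tendsto_iff_edist_tendsto_0.1 huL
  simpa only [MeasuredSets.edist_def, hL] using this

end Torus

open Torus in
theorem proposition4p5 (N : ℕ) (hN : 2 ≤ N) (h : ℝ) (hh : 0 < h) :
    ∃ (m : ℝ) (En : ℕ → Set (Torus N)) (E F : Set (Torus N)),
      0 < m ∧ Torus.IsLamella E ∧ MeasurableSet F ∧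
      (∀ n, MeasurableSet (En n) ∧ Torus.lebesgueRep (En n) = En n ∧
        Torus.vol N (En n) = ENNReal.ofReal m) ∧
      (∃ C : ℝ≥0, ∀ n, Torus.perimeter (En n) ≤ (C : ℝ≥0∞)) ∧
      Tendsto (fun n => Torus.vol N (En n ∆ E)) atTop (𝓝 0) ∧
      Tendsto (fun n => Torus.perimeter (En n)) atTop (𝓝 (Torus.perimeter E)) ∧
      (∀ n, ∃ G : Set (Torus N), Torus.IsVolumeConstrainedMinimizer h (En n) G) ∧
      (∀ Fn : ℕ → Set (Torus N),
        (∀ n, Torus.IsVolumeConstrainedMinimizer h (En n) (Fn n)) →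
          Tendsto (fun n => Torus.vol N (Fn n ∆ F)) atTop (𝓝 0)) ∧
      0 < Torus.vol N (E ∆ F) := by
  set i : Fin N := ⟨0, by omega⟩ with hi
  set E : Set (Torus N) := strip i (1 / 32) with hE
  have hEm : MeasurableSet E := (isOpen_strip i _).measurableSet
  obtain ⟨Q, hQm, hQv, hQp⟩ := exists_perimeter_le_one hN
  have hQfin : perimeter Q ≠ ⊤ := ne_top_of_le_ne_top ENNReal.one_ne_top hQp
  obtain ⟨F, hFm, hFv, hFmin, hFcl⟩ := exists_isoperimetric_closest hQm hQv hQfin E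
  have hFp : perimeter F ≤ 1 := (hFmin Q hQm hQv).trans hQp
  have hFfin : perimeter F ≠ ⊤ := ne_top_of_le_ne_top ENNReal.one_ne_top hFp
  set η : ℕ → ℝ := fun n => 1 / ((n : ℝ) + 1) with hη
  have hη0 : ∀ n, 0 < η n := fun n => Nat.one_div_pos_of_nat
  have hη1 : ∀ n, η n ≤ 1 := fun n => by
    have := Nat.one_div_le_one_div (α := ℝ) (Nat.zero_le n)
    simpa [hη] using this
  have hηlim : ∀ a : ℝ, Tendsto (fun n => ENNReal.ofReal (a * η n)) atTop (𝓝 0) := fun a => by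
    have h1 := (tendsto_one_div_add_atTop_nhds_zero_nat (𝕜 := ℝ)).const_mul a
    rw [mul_zero] at h1
    have h2 := ENNReal.tendsto_ofReal h1
    rwa [ENNReal.ofReal_zero] at h2
  choose En ε hEnm hEnr hEnv hEnp hEnE hε0 hε1 hsmall hlarge using fun n =>
    exists_perforated_strip hN i (hFm.symmDiff hEm) (hη0 n)
  have hE2 : perimeter E = ENNReal.ofReal 2 :=
    le_antisymm (perimeter_strip_le i (by norm_num) (by norm_num)) (two_le_perimeter_strip i)
  have hconv : Tendsto (fun n => vol N (En n ∆ E)) atTop (𝓝 0) := by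
    refine tendsto_of_tendsto_of_tendsto_of_le_of_le tendsto_const_nhds (hηlim 1)
      (fun _ => zero_le) fun n => ?_
    simp only [one_mul]
    exact vol_le_ofReal (hEnE n)
  refine ⟨1 / 16, En, E, F, by norm_num, isLamella_strip i, hFm,
    fun n => ⟨hEnm n, hEnr n, hEnv n⟩, ⟨3, fun n => (hEnp n).trans ?_⟩, hconv, ?_,
    fun n => exists_isVolumeConstrainedMinimizer h hQm (hQv.trans (hEnv n).symm) hQfin,
    fun Fn hFn => ?_, ?_⟩
  · rw [ENNReal.ofReal_le_iff_le_toReal ENNReal.coe_ne_top]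
    norm_num
    linarith [hη1 n]
  · have hup : Tendsto (fun n => ENNReal.ofReal (2 + η n)) atTop (𝓝 (perimeter E)) := by
      have h1 := (tendsto_one_div_add_atTop_nhds_zero_nat (𝕜 := ℝ)).const_add 2
      rw [add_zero] at h1
      rw [hE2]
      exact ENNReal.tendsto_ofReal h1
    refine tendsto_order.2 ⟨fun c hc => ?_, fun c hc => ?_⟩
    · obtain ⟨L, hL⟩ : ∃ L : MeasuredSets (vol N), (L : Set (Torus N)) = E := ⟨⟨E, hEm⟩, rfl⟩
      obtain ⟨v, hv⟩ : ∃ v : ℕ → MeasuredSets (vol N), ∀ n, (v n : Set (Torus N)) = En n :=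
        ⟨fun n => ⟨En n, hEnm n⟩, fun _ => rfl⟩
      have hlim : Tendsto v atTop (𝓝 L) := by
        rw [tendsto_iff_edist_tendsto_0]
        simpa only [MeasuredSets.edist_def, hv, hL] using hconv
      have hcL : c < perimeter (L : Set (Torus N)) := by rwa [hL]
      have hev := hlim.eventually (lowerSemicontinuous_perimeter L c hcL)
      simpa only [hv] using hev
    · filter_upwards [hup.eventually (gt_mem_nhds hc)] with n hn using (hEnp n).trans_lt hn
  · have hest := fun n => (hFn n).estimates hh (hEnm n) hFm (hFv.trans (hEnv n).symm) hFfin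
      (hFmin (Fn n) (hFn n).1 ((hFn n).2.1.trans (hEnv n))) (hη0 n).le (hε0 n) (hε1 n)
      (hEnE n) (hsmall n) (hlarge n)
    refine tendsto_of_isoperimetric_closest (u := fun n => ⟨Fn n, (hFn n).1⟩)
      (a := fun n => ENNReal.ofReal (1 / h) * ENNReal.ofReal (η n))
      (b := fun n => ENNReal.ofReal (3 * η n)) hEm hFm hFfin hFcl
      (fun n => (hFn n).2.1.trans (hEnv n)) ?_ (hηlim 3) (fun n => ?_)
      (ENNReal.mul_ne_top ENNReal.ofReal_ne_top ENNReal.ofReal_ne_top)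
      (fun n => (hest n).1) (fun n => (hest n).2)
    · have := ENNReal.Tendsto.const_mul (a := ENNReal.ofReal (1 / h)) (hηlim 1)
        (Or.inr ENNReal.ofReal_ne_top)
      simpa using this
    · refine mul_le_mul_right (ENNReal.ofReal_le_ofReal ?_) _
      refine (hη1 n).trans (le_of_eq ?_)
      simp [hη]
  · rw [pos_iff_ne_zero]
    intro h0
    have := perimeter_congr (measure_symmDiff_eq_zero_iff.1 h0)
    rw [hE2] at this
    rw [← this] at hFp
    exact absurd hFp (by norm_num)
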